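/- Let $S$ be a complete separable metric space with Borel $\sigma$-algebra $\mathbf S$. A random measure on $S$ is a map $\omega\mapsto\xi(\omega,\cdot)$ from a probability space to the measures on $\mathbf S$ that are finite on bounded Borel sets, such that $\omega\mapsto\xi(\omega,B)$ is measurable for every $B\in\mathbf S$; it is completely random (a CRM) if $\xi(B_1),\dots,\xi(B_k)$ are independent whenever $B_1,\dots,B_k\in\mathbf S$ are disjoint, and atomless if $\xi(\{s\})=0$ a.s. for every $s\in S$. The Lévy measure of an atomless CRM $\alpha$ is the intensity $C\mapsto \mathbb E\,\#\{s:\alpha(\{s\})>0,\ (s,\alpha(\{s\}))\in C\}$ of its jumps. A real random variable $\beta$ is quasi-infinitely divisible (QID) with drift $c\in\mathbb R$, Gaussian variance $0$ and finite quasi-Lévy measure $b$, where $b$ is a finite signed measure on $\mathbb R$ with $b(\{0\})=0$, if $\mathbb E e^{i\theta\beta}=\exp\big(i\theta c+\int_{\mathbb R}(e^{i\theta x}-1)\,b(dx)\big)$ for all $\theta\in\mathbb R$. Let $\mathcal A$ be the class of CRMs $\xi$ on $S$ such that, a.s., $\xi=\alpha+\sum_{j=1}^n\beta_j\delta_{s_j}$,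 where $\alpha$ is an atomless, a.s. finite CRM with finite Lévy measure, $n\ge 0$, $s_1,\dots,s_n\in S$ are distinct, and the $\beta_j$ are $[0,\infty)$-valued QID random variables with finite quasi-Lévy measure and zero Gaussian variance, mutually independent and independent of $\alpha$. For a finite signed measure $b$ on $\mathbb R$ put $\exp(b)=\sum_{k\ge 0}b^{*k}/k!$. A characteristic pair is a pair $(\nu_0,F)$ of finite signed measures on $\mathbf S$ and on $\mathbf S\otimes\mathcal B(\mathbb R)$ such that, for some $n\ge0$, distinct $s_1,\dots,s_n\in S$ and all $A\in\mathbf S$, $B\in\mathcal B(\mathbb R)$: (i) $\nu_0(A)=\gamma(A)+\sum_{j=1}^n\delta_{s_j}(A)c_j$, for a diffuse finite measure $\gamma$ on $\mathbf S$ and $c_1,\dots,c_n\in\mathbb R$; (ii) $F(A\times B)=\tilde G(A\times B)+\sum_{j=1}^n\delta_{s_j}(A)b_j(B)$, where $\tilde G$ is the extension by zero of a finite measure $G$ on $\mathbf S\otimes\mathcal B((0,\infty))$ all of whose projections $G(\cdot\times B')$ onto $S$ are diffuse, and $b_1,\dots,b_n$ are finite signed measures on $\mathcal B(\mathbb R)$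 such that each $\exp(b_j)$ is a (positive) measure; (iii) each measure $\delta_{c_j}*\exp(b_j)$ is concentrated on $[0,\infty)$. **Theorem.** For every $\xi\in\mathcal A$ there is a characteristic pair $(\nu_0,F)$ such that, with $F_A(B)=F(A\times B)$, $$\mathbb E\,e^{i\theta\xi(A)}=\exp\Big(i\theta\,\nu_0(A)+\int_{\mathbb R}(e^{i\theta x}-1)\,F_A(dx)\Big)\qquad(\theta\in\mathbb R,\ A\in\mathbf S).\tag{$*$}$$ Conversely, for every characteristic pair $(\nu_0,F)$ there is a random measure $\xi\in\mathcal A$, unique in law, such that $(*)$ holds. -/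

import Mathlib

open MeasureTheory ProbabilityTheory Set
open scoped ENNReal NNReal

universe u v w

noncomputable section

namespace QIDMeasure

/-! ### Signed measures on the line -/

/-- Convolution of finite signed measures on `ℝ`: the image of the product measure under
addition. -/
def conv (a b : SignedMeasure ℝ) : SignedMeasure ℝ :=
  (a.prod b (ContinuousLinearMap.mul ℝ ℝ)).map (fun p : ℝ × ℝ => p.1 + p.2)

/-- The convolution powers `b^{*n}`, with `b^{*0} = δ₀`. -/
def convPow (b : SignedMeasure ℝ) : ℕ → SignedMeasure ℝ
  | 0 => (Measure.dirac (0 : ℝ)).toSignedMeasure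
  | n + 1 => conv (convPow b n) b

/-- The exponential `exp(b) = ∑_{n ≥ 0} b^{*n} / n!` is the (positive, finite) measure `m`. -/
def IsExp (b : SignedMeasure ℝ) (m : Measure ℝ) : Prop :=
  IsFiniteMeasure m ∧
    ∀ B : Set ℝ, MeasurableSet B →
      HasSum (fun n : ℕ => convPow b n B / (n.factorial : ℝ)) (m.real B)

/-- `μ` has the Lévy–Khintchine representation with drift `c`, Gaussian variance `a` and finite
quasi-Lévy measure `b`, with centering function zero. As usual, a quasi-Lévy measure
does not charge the origin. -/
def HasCharTriplet (μ : Measure ℝ) (c a : ℝ) (b : SignedMeasure ℝ) : Prop :=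
  b {0} = 0 ∧
    ∀ θ : ℝ, charFun μ θ =
      Complex.exp (Complex.I * θ * c - (θ : ℂ) ^ 2 / 2 * a
        + ∫ᵛ x, (Complex.exp (Complex.I * θ * x) - 1) ∂<•b)

/-! ### Random measures -/

section RandomMeasures

variable {S : Type*} [MetricSpace S] [MeasurableSpace S]
variable {Ω : Type*} [MeasurableSpace Ω]

/-- A random measure on `S`: `ω ↦ ξ ω B` is measurable for every Borel set `B` (this is what
measurability into `Measure S` means), and every `ξ ω` is finite on bounded Borel sets. -/
def IsRandomMeasure (ξ : Ω → Measure S) : Prop :=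
  Measurable ξ ∧
    ∀ ω, ∀ B : Set S, MeasurableSet B → Bornology.IsBounded B → ξ ω B < ∞

/-- A completely random measure: the values on disjoint Borel sets are independent. -/
def IsCRM (P : Measure Ω) (ξ : Ω → Measure S) : Prop :=
  IsRandomMeasure ξ ∧
    ∀ (k : ℕ) (B : Fin k → Set S), (∀ i, MeasurableSet (B i)) →
      Pairwise (fun i j => Disjoint (B i) (B j)) →
        iIndepFun (fun (i : Fin k) (ω : Ω) => ξ ω (B i)) P

/-- No fixed atoms. -/
def IsAtomless (P : Measure Ω) (ξ : Ω → Measure S) : Prop :=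
  ∀ s : S, ∀ᵐ ω ∂P, ξ ω {s} = 0

/-- The point measure `∑ δ_{(s, μ{s})}` of the jumps of `μ`, the sum running over all atoms `s`
of `μ`. -/
def jumpMeasure (μ : Measure S) : Measure (S × ℝ) :=
  Measure.sum fun s : {s : S // μ {s} ≠ 0} => Measure.dirac (s.1, (μ {s.1}).toReal)

/-- The Lévy measure of an atomless completely random measure `α`: the intensity of its
jump point process, `C ↦ E[#{s : α{s} > 0, (s, α{s}) ∈ C}]`. (In the representation
`α = γ + ∫∫ x δ_s η(ds dx)` with `γ` diffuse and `η` a Poisson process on `S × (0, ∞)`, the jump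
point process is `η`.) -/
def levyMeasure (P : Measure Ω) (α : Ω → Measure S) (C : Set (S × ℝ)) : ℝ≥0∞ :=
  ∫⁻ ω, jumpMeasure (α ω) C ∂P

/-- The class `𝒜`: completely random measures that are a.s. of the form `α + ∑ⱼ βⱼ δ_{sⱼ}`, with
`α` an atomless, a.s. finite completely random measure with finite Lévy measure, finitely many
points `sⱼ`, and `[0, ∞)`-valued quasi-infinitely divisible `βⱼ` with finite quasi-Lévy measure
and zero Gaussian variance that are mutually independent and independent of `α`. -/
def InClassA (P : Measure Ω) (ξ : Ω → Measure S) : Prop :=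
  IsCRM P ξ ∧
  ∃ (α : Ω → Measure S) (n : ℕ) (s : Fin n → S) (β : Fin n → Ω → ℝ≥0),
    IsCRM P α ∧ IsAtomless P α ∧ (∀ᵐ ω ∂P, α ω univ < ∞) ∧ levyMeasure P α univ < ∞ ∧
    Function.Injective s ∧
    (∀ j, Measurable (β j)) ∧
    (∀ j, ∃ (c : ℝ) (b : SignedMeasure ℝ),
      HasCharTriplet (P.map fun ω => (β j ω : ℝ)) c 0 b) ∧
    iIndepFun β P ∧
    IndepFun (fun ω j => β j ω) α P ∧
    ∀ᵐ ω ∂P, ξ ω = α ω + ∑ j, β j ω • Measure.dirac (s j)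

/-- The signed measure `F_A(B) = F(A × B)` on `ℝ`. -/
def slice (F : SignedMeasure (S × ℝ)) (A : Set S) : SignedMeasure ℝ :=
  (F.restrict (A ×ˢ (univ : Set ℝ))).map Prod.snd

/-- The Lévy–Khintchine formula (with centering function zero):
`E[exp(iθ ξ(A))] = exp(iθ ν₀(A) + ∫ (e^{iθx} - 1) F_A(dx))` for all `θ` and all Borel `A`. -/
def LevyKhintchine (P : Measure Ω) (ξ : Ω → Measure S)
    (ν₀ : SignedMeasure S) (F : SignedMeasure (S × ℝ)) : Prop :=
  ∀ A : Set S, MeasurableSet A → (∀ᵐ ω ∂P, ξ ω A < ∞) ∧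
    ∀ θ : ℝ, charFun (P.map fun ω => (ξ ω A).toReal) θ =
      Complex.exp (Complex.I * θ * (ν₀ A : ℝ)
        + ∫ᵛ x, (Complex.exp (Complex.I * θ * x) - 1) ∂<•(slice F A))

/-- Characteristic pairs: `ν₀ = γ + ∑ⱼ cⱼ δ_{sⱼ}` with `γ` a finite diffuse measure, and
`F = G̃ + ∑ⱼ δ_{sⱼ} ⊗ bⱼ`, where `G̃` is the extension by zero of a finite measure `G` on
`S × (0, ∞)` with diffuse projections onto `S`, and where `exp(bⱼ)` is a measure and
`δ_{cⱼ} * exp(bⱼ)` is concentrated on `[0, ∞)`. -/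
def IsCharPair (ν₀ : SignedMeasure S) (F : SignedMeasure (S × ℝ)) : Prop :=
  ∃ (γ : Measure S) (G : Measure (S × Ioi (0 : ℝ))) (n : ℕ) (s : Fin n → S)
    (c : Fin n → ℝ) (b : Fin n → SignedMeasure ℝ),
    IsFiniteMeasure γ ∧ (∀ x : S, γ {x} = 0) ∧
    IsFiniteMeasure G ∧
    (∀ B : Set (Ioi (0 : ℝ)), MeasurableSet B → ∀ x : S, G ({x} ×ˢ B) = 0) ∧
    Function.Injective s ∧
    (∀ j, ∃ m : Measure ℝ, IsExp (b j) m ∧ (Measure.dirac (c j) ∗ m) (Iio 0) = 0) ∧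
    (∀ A : Set S, MeasurableSet A →
      ν₀ A = γ.real A + ∑ j, (Measure.dirac (s j)).real A * c j) ∧
    (∀ (A : Set S) (B : Set ℝ), MeasurableSet A → MeasurableSet B →
      F (A ×ˢ B) =
        (G.map (Prod.map id Subtype.val : S × Ioi (0 : ℝ) → S × ℝ)).real (A ×ˢ B)
          + ∑ j, (Measure.dirac (s j)).real A * b j B)

end RandomMeasures

end QIDMeasure

end

/-!
The characteristic function of `ξ(A)` is computed without a Poisson representation of `ξ`, from
three facts.

* *Exponentials of signed measures* (`isExp_iff`). Writing `b = p - q` with finite measures and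
  expanding, `exp(b)` is a difference of two finite measures, with characteristic function
  `exp(b(ℝ) + ∫ (e^{iθx} - 1) b(dx))`. Hence `δ_c * exp(b)` is a measure on `[0, ∞)` exactly when,
  after normalisation, it is a `[0, ∞)`-valued quasi-infinitely divisible law with drift `c` and
  quasi-Lévy measure `b` (up to an irrelevant atom of `b` at the origin).
* *Atomless completely random measures* (`IsCRM.exists_charFun_eq`). Let `(A_w)` be the traces on
  `A` of the `n`-th of a sequence of nested finite partitions that separate points. The `α(A_w)` are
  independent, and with `A_n(x)` the trace that contains `x`,
  `∑_w (e^{iθα(A_w)} - 1) = ∫_A h(α(A_n(x))) α(dx)`, where `h(y) = (e^{iθy} - 1) / y` and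
  `h(0) = iθ`. As `A_n(x)` decreases to `{x}`, the integral converges to `∫_A h(α{x}) α(dx)`, which
  is `iθ` times the mass of the diffuse part of `α` plus the sum of `e^{iθy} - 1` over the atoms, of
  mass `y`. The expectations converge as well: with `min(1, y)` in place of `e^{iθy} - 1`,
  independence bounds the sums in terms of `-log E e^{-α(S)}`, and Fatou's lemma gives a dominating
  function. Since `α` has no fixed atom, the same domination shows that `(α(A_w))` is a null array,
  for which `∏ z_w` and `exp(∑ (z_w - 1))` are asymptotically equal, where `z_w = E e^{iθα(A_w)}`.
  So `E e^{iθα(A)} = exp(E ∫_A h(α{x}) α(dx))`, and the mean measures of the diffuse part and of the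
  jumps are the `γ` and the `G` of the characteristic pair.
* *Fixed atoms* (`charFun_map_sum_add_atoms`). Independent fixed atoms contribute additively to the
  exponent, jointly for disjoint sets, since every atom lies in at most one of them.

Conversely, `IsCharPair.exists_inClassA` takes for `α` the measure `γ` plus a finite Poisson
process of atoms with intensity `G`, and adds independent fixed atoms; complete randomness is read
off from the factorisation of the joint characteristic functions. For uniqueness
(`LevyKhintchine.map_eq`), the law of a completely random measure is determined by the laws of its
values on single sets, since finitely many sets generate a finite algebra, on whose atoms the values
are independent.
-/

noncomputable section

namespace QIDMeasure

/-! ### Exponentials of finite signed measures on the line -/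

/-- The Jordan decomposition written as an identity of signed measures. -/
lemma toSignedMeasure_posPart_sub_negPart {X : Type*} [MeasurableSpace X] (b : SignedMeasure X) :
    b.toJordanDecomposition.posPart.toSignedMeasure
      - b.toJordanDecomposition.negPart.toSignedMeasure = b :=
  SignedMeasure.toSignedMeasure_toJordanDecomposition b

instance isFiniteMeasure_variation {X : Type*} [MeasurableSpace X] (b : SignedMeasure X) :
    IsFiniteMeasure b.variation := by
  rw [← SignedMeasure.totalVariation_eq_variation, SignedMeasure.totalVariation]
  infer_instance

lemma conv_apply_sub (p₁ q₁ p₂ q₂ : Measure ℝ) [IsFiniteMeasure p₁] [IsFiniteMeasure q₁]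
    [IsFiniteMeasure p₂] [IsFiniteMeasure q₂] :
    conv (p₁.toSignedMeasure - q₁.toSignedMeasure) (p₂.toSignedMeasure - q₂.toSignedMeasure) =
      (p₁ ∗ p₂ + q₁ ∗ q₂).toSignedMeasure - (p₁ ∗ q₂ + q₁ ∗ p₂).toSignedMeasure := by
  have h : (p₁.toSignedMeasure - q₁.toSignedMeasure).prod
      (p₂.toSignedMeasure - q₂.toSignedMeasure) (ContinuousLinearMap.mul ℝ ℝ) =
      (p₁.prod p₂ + q₁.prod q₂).toSignedMeasure - (p₁.prod q₂ + q₁.prod p₂).toSignedMeasure := by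
    refine VectorMeasure.prod_eq_of_forall_apply_prod fun s t hs ht ↦ ?_
    simp [hs, ht, hs.prod ht, measureReal_prod_prod]
    ring
  have hm : Measurable (fun p : ℝ × ℝ => p.1 + p.2) := by fun_prop
  ext B hB
  rw [conv, h, VectorMeasure.map_apply _ hm hB]
  simp [hB, hm hB, Measure.conv, map_measureReal_apply hm hB]

/-- Finite measures `(p_n, q_n)` with `p_n - q_n = (p - q)^{*n}`, obtained by expanding the
convolution power. -/
def convPair (p q : Measure ℝ) : ℕ → Measure ℝ × Measure ℝ
  | 0 => (Measure.dirac 0, 0)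
  | n + 1 => ((convPair p q n).1 ∗ p + (convPair p q n).2 ∗ q,
      (convPair p q n).1 ∗ q + (convPair p q n).2 ∗ p)

section

variable (p q : Measure ℝ) [IsFiniteMeasure p] [IsFiniteMeasure q]

lemma isFiniteMeasure_convPair (n : ℕ) :
    IsFiniteMeasure (convPair p q n).1 ∧ IsFiniteMeasure (convPair p q n).2 := by
  induction n with
  | zero => exact ⟨by simp only [convPair]; infer_instance, by simp only [convPair]; infer_instance⟩
  | succ n ih =>
    have := ih.1
    have := ih.2
    exact ⟨by simp only [convPair]; infer_instance, by simp only [convPair]; infer_instance⟩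

instance (n : ℕ) : IsFiniteMeasure (convPair p q n).1 := (isFiniteMeasure_convPair p q n).1

instance (n : ℕ) : IsFiniteMeasure (convPair p q n).2 := (isFiniteMeasure_convPair p q n).2

lemma convPow_eq_sub (n : ℕ) :
    convPow (p.toSignedMeasure - q.toSignedMeasure) n =
      (convPair p q n).1.toSignedMeasure - (convPair p q n).2.toSignedMeasure := by
  induction n with
  | zero => ext B hB; simp [convPow, convPair]
  | succ n ih => rw [convPow, ih, conv_apply_sub]; rfl

lemma convPair_univ (n : ℕ) :
    (convPair p q n).1 univ + (convPair p q n).2 univ = (p univ + q univ) ^ n := by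
  induction n with
  | zero => simp [convPair]
  | succ n ih =>
    have key : ∀ a b : Measure ℝ, IsFiniteMeasure a → IsFiniteMeasure b →
        (a ∗ b) univ = a univ * b univ := by
      intro a b _ _
      rw [Measure.conv, Measure.map_apply (by fun_prop) .univ, preimage_univ, ← univ_prod_univ,
        Measure.prod_prod]
    simp only [convPair, Measure.add_apply]
    rw [key _ _ inferInstance inferInstance, key _ _ inferInstance inferInstance,
      key _ _ inferInstance inferInstance, key _ _ inferInstance inferInstance, pow_succ, ← ih]
    ring

lemma charFun_add_measure (μ ν : Measure ℝ) [IsFiniteMeasure μ] [IsFiniteMeasure ν] (θ : ℝ) :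
    charFun (μ + ν) θ = charFun μ θ + charFun ν θ := by
  simp only [charFun_eq_integral_innerProbChar]
  exact integral_add_measure (BoundedContinuousFunction.integrable _ _)
    (BoundedContinuousFunction.integrable _ _)

lemma charFun_smul_measure {E : Type*} [MeasurableSpace E] [NormedAddCommGroup E]
    [InnerProductSpace ℝ E] (c : ℝ≥0∞) (μ : Measure E) (θ : E) :
    charFun (c • μ) θ = c.toReal * charFun μ θ := by
  simp only [charFun_apply, integral_smul_measure, Complex.real_smul]

lemma charFun_convPair (n : ℕ) (θ : ℝ) :
    charFun (convPair p q n).1 θ - charFun (convPair p q n).2 θ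
      = (charFun p θ - charFun q θ) ^ n := by
  induction n with
  | zero => simp [convPair, charFun_dirac]
  | succ n ih =>
    simp only [convPair, charFun_add_measure, charFun_conv, pow_succ, ← ih]
    ring

/-- The exponential series `∑ m_n / n!` of a sequence of measures. -/
def expSum (m : ℕ → Measure ℝ) : Measure ℝ :=
  Measure.sum fun n ↦ ((n.factorial : ℝ≥0∞))⁻¹ • m n

lemma expSum_univ_le {m : ℕ → Measure ℝ} {r : ℝ≥0} (hm : ∀ n, m n univ ≤ r ^ n) :
    expSum m univ ≤ ENNReal.ofReal (Real.exp r) := by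
  rw [expSum, Measure.sum_apply _ .univ, Real.exp_eq_exp_ℝ, NormedSpace.exp_eq_tsum_div]
  rw [ENNReal.ofReal_tsum_of_nonneg (fun n ↦ by positivity) (Real.summable_pow_div_factorial r)]
  refine ENNReal.tsum_le_tsum fun n ↦ ?_
  rw [Measure.smul_apply, smul_eq_mul, ENNReal.ofReal_div_of_pos (by positivity),
    ENNReal.ofReal_pow (by positivity), ENNReal.ofReal_natCast, ENNReal.ofReal_coe_nnreal,
    ENNReal.div_eq_inv_mul]
  gcongr
  exact hm n

lemma isFiniteMeasure_expSum {m : ℕ → Measure ℝ} {r : ℝ≥0} (hm : ∀ n, m n univ ≤ r ^ n) :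
    IsFiniteMeasure (expSum m) :=
  ⟨(expSum_univ_le hm).trans_lt ENNReal.ofReal_lt_top⟩

lemma hasSum_expSum_real (m : ℕ → Measure ℝ) [∀ n, IsFiniteMeasure (m n)]
    [IsFiniteMeasure (expSum m)] {B : Set ℝ} (hB : MeasurableSet B) :
    HasSum (fun n : ℕ ↦ (m n).real B / (n.factorial : ℝ)) ((expSum m).real B) := by
  have h : expSum m B = ∑' n, ((n.factorial : ℝ≥0∞))⁻¹ * m n B := by
    simp [expSum, Measure.sum_apply _ hB]
  have h2 := ENNReal.hasSum_toReal (f := fun n ↦ ((n.factorial : ℝ≥0∞))⁻¹ * m n B)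
    (by rw [← h]; exact measure_ne_top _ _)
  rw [← ENNReal.tsum_toReal_eq (fun n ↦ by finiteness), ← h] at h2
  refine Eq.subst (motive := fun f ↦ HasSum f _) (funext fun n ↦ Eq.symm ?_) h2
  simp [measureReal_def, div_eq_inv_mul]

lemma hasSum_charFun_expSum (m : ℕ → Measure ℝ) [∀ n, IsFiniteMeasure (m n)]
    [IsFiniteMeasure (expSum m)] (θ : ℝ) :
    HasSum (fun n : ℕ ↦ charFun (m n) θ / (n.factorial : ℂ)) (charFun (expSum m) θ) := by
  have h := hasSum_integral_measure (f := BoundedContinuousFunction.innerProbChar θ)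
    (μ := fun n ↦ ((n.factorial : ℝ≥0∞))⁻¹ • m n)
    (BoundedContinuousFunction.integrable (expSum m) _)
  simp only [← charFun_eq_integral_innerProbChar] at h
  refine Eq.subst (motive := fun f ↦ HasSum f _) (funext fun n ↦ Eq.symm ?_) h
  rw [charFun_smul_measure]
  simp [div_eq_inv_mul]

/-- The positive part of the expansion of `exp(p - q)`. -/
def expPos : Measure ℝ := expSum fun n ↦ (convPair p q n).1

/-- The negative part of the expansion of `exp(p - q)`. -/
def expNeg : Measure ℝ := expSum fun n ↦ (convPair p q n).2

lemma convPair_univ_le (n : ℕ) :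
    (convPair p q n).1 univ ≤ ((p univ + q univ).toNNReal : ℝ≥0∞) ^ n ∧
      (convPair p q n).2 univ ≤ ((p univ + q univ).toNNReal : ℝ≥0∞) ^ n := by
  rw [ENNReal.coe_toNNReal (by finiteness), ← convPair_univ]
  exact ⟨le_self_add, le_add_self⟩

instance : IsFiniteMeasure (expSum fun n ↦ (convPair p q n).1) :=
  isFiniteMeasure_expSum fun n ↦ (convPair_univ_le p q n).1

instance : IsFiniteMeasure (expSum fun n ↦ (convPair p q n).2) :=
  isFiniteMeasure_expSum fun n ↦ (convPair_univ_le p q n).2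

instance : IsFiniteMeasure (expPos p q) := by unfold expPos; infer_instance

instance : IsFiniteMeasure (expNeg p q) := by unfold expNeg; infer_instance

lemma charFun_expPos_sub_expNeg (θ : ℝ) :
    charFun (expPos p q) θ - charFun (expNeg p q) θ
      = Complex.exp (charFun p θ - charFun q θ) := by
  have h := (hasSum_charFun_expSum (fun n ↦ (convPair p q n).1) θ).sub
    (hasSum_charFun_expSum (fun n ↦ (convPair p q n).2) θ)
  simp only [← sub_div, charFun_convPair] at h
  refine h.unique ?_
  rw [Complex.exp_eq_exp_ℂ]
  exact NormedSpace.expSeries_div_hasSum_exp _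

lemma hasSum_convPow (B : Set ℝ) (hB : MeasurableSet B) :
    HasSum (fun n : ℕ ↦
        convPow (p.toSignedMeasure - q.toSignedMeasure) n B / (n.factorial : ℝ))
      ((expPos p q).real B - (expNeg p q).real B) := by
  have h := (hasSum_expSum_real (fun n ↦ (convPair p q n).1) hB).sub
    (hasSum_expSum_real (fun n ↦ (convPair p q n).2) hB)
  refine Eq.subst (motive := fun f ↦ HasSum f _) (funext fun n ↦ Eq.symm ?_) h
  rw [convPow_eq_sub, ← sub_div]
  simp [Measure.toSignedMeasure_apply_measurable hB]

/-- As `exp(p - q) = expPos p q - expNeg p q`, the relation `exp(p - q) = m` is the identity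
`m + expNeg p q = expPos p q` of finite measures, which characteristic functions detect. -/
lemma isExp_sub_iff (m : Measure ℝ) [IsFiniteMeasure m] :
    IsExp (p.toSignedMeasure - q.toSignedMeasure) m ↔
      ∀ θ : ℝ, charFun m θ = Complex.exp (charFun p θ - charFun q θ) := by
  have h1 : IsExp (p.toSignedMeasure - q.toSignedMeasure) m ↔ m + expNeg p q = expPos p q := by
    constructor
    · rintro ⟨_, h⟩
      ext B hB
      have := (h B hB).unique (hasSum_convPow p q B hB)
      rw [← measureReal_eq_measureReal_iff, measureReal_add_apply]
      linarith
    · intro h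
      refine ⟨inferInstance, fun B hB ↦ ?_⟩
      convert hasSum_convPow p q B hB using 1
      rw [← h, measureReal_add_apply]
      ring
  rw [h1]
  constructor
  · intro h θ
    rw [← charFun_expPos_sub_expNeg, ← h, charFun_add_measure]
    ring
  · intro h
    refine Measure.ext_of_charFun ?_
    ext θ
    rw [charFun_add_measure, h, ← charFun_expPos_sub_expNeg]
    ring

end

/-! ### Characteristic exponents of signed measures -/

lemma integrable_exp_sub_one (μ : Measure ℝ) [IsFiniteMeasure μ] (θ : ℝ) :
    Integrable (fun x : ℝ ↦ Complex.exp (Complex.I * θ * x) - 1) μ := by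
  refine Integrable.of_bound (C := 2) (by fun_prop) (ae_of_all _ fun x ↦ ?_)
  calc _ ≤ ‖Complex.exp (Complex.I * θ * x)‖ + ‖(1 : ℂ)‖ := norm_sub_le _ _
    _ = 2 := by
      rw [show Complex.I * θ * x = ((θ * x : ℝ) : ℂ) * Complex.I by push_cast; ring,
        Complex.norm_exp_ofReal_mul_I]
      norm_num

lemma integrable_exp_sub_one_vectorMeasure (b : SignedMeasure ℝ) (θ : ℝ) :
    b.Integrable (fun x : ℝ ↦ Complex.exp (Complex.I * θ * x) - 1) :=
  integrable_exp_sub_one _ θ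

lemma integral_exp_sub_one (μ : Measure ℝ) [IsFiniteMeasure μ] (θ : ℝ) :
    ∫ x, (Complex.exp (Complex.I * θ * x) - 1) ∂μ = charFun μ θ - μ.real univ := by
  have h : ∀ x : ℝ, Complex.exp (Complex.I * θ * x)
      = (BoundedContinuousFunction.innerProbChar θ : ℝ → ℂ) x := by
    intro x
    rw [BoundedContinuousFunction.innerProbChar_apply]
    congr 1
    simp
    ring
  simp only [h]
  rw [integral_sub (BoundedContinuousFunction.integrable _ _) (integrable_const _),
    ← charFun_eq_integral_innerProbChar]
  simp

/-- Up to normalisation, the exponential of a finite signed measure is characterised by its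
characteristic function, as for compound Poisson laws. -/
lemma isExp_iff (b : SignedMeasure ℝ) (m : Measure ℝ) [IsFiniteMeasure m] :
    IsExp b m ↔ ∀ θ : ℝ, charFun m θ = Complex.exp
      ((b univ : ℝ) + ∫ᵛ x, (Complex.exp (Complex.I * θ * x) - 1) ∂<•b) := by
  conv_lhs => rw [← toSignedMeasure_posPart_sub_negPart b]
  rw [isExp_sub_iff]
  refine forall_congr' fun θ ↦ ?_
  conv_rhs => rw [← toSignedMeasure_posPart_sub_negPart b]
  rw [VectorMeasure.integral_sub_vectorMeasure (integrable_exp_sub_one_vectorMeasure _ _)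
    (integrable_exp_sub_one_vectorMeasure _ _), VectorMeasure.integral_toSignedMeasure,
    VectorMeasure.integral_toSignedMeasure, integral_exp_sub_one, integral_exp_sub_one]
  simp only [sub_apply, Measure.toSignedMeasure_apply_measurable MeasurableSet.univ]
  congr! 2
  push_cast
  ring

/-! ### Quasi-infinitely divisible laws on the half-line -/

/-- A `[0, ∞)`-valued law with drift `c` and quasi-Lévy measure `b` is, up to a constant,
`δ_c * exp(b)`. In particular `exp(b)` is a positive measure. -/
lemma exists_isExp_of_hasCharTriplet {μ : Measure ℝ} [IsFiniteMeasure μ] (hμ : μ (Iio 0) = 0)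
    {c : ℝ} {b : SignedMeasure ℝ} (h : HasCharTriplet μ c 0 b) :
    ∃ m : Measure ℝ, IsExp b m ∧ (Measure.dirac c ∗ m) (Iio 0) = 0 := by
  set r : ℝ≥0∞ := ENNReal.ofReal (Real.exp (b univ)) with hr
  have hr' : r.toReal = Real.exp (b univ) := ENNReal.toReal_ofReal (Real.exp_pos _).le
  have hfin : ∀ ν : Measure ℝ, IsFiniteMeasure ν → IsFiniteMeasure (r • ν) := fun ν _ ↦
    Measure.smul_finite _ ENNReal.ofReal_ne_top
  have h1 := hfin (Measure.dirac (-c) ∗ μ) inferInstance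
  have h2 := hfin μ inferInstance
  refine ⟨r • (Measure.dirac (-c) ∗ μ), (isExp_iff _ _).2 fun θ ↦ ?_, ?_⟩
  · rw [charFun_smul_measure, charFun_conv, charFun_dirac, h.2, hr']
    push_cast
    rw [← Complex.exp_add, ← Complex.exp_add]
    congr 1
    simp
    ring
  · have : Measure.dirac c ∗ (r • (Measure.dirac (-c) ∗ μ)) = r • μ := by
      refine Measure.ext_of_charFun ?_
      ext θ
      rw [charFun_conv, charFun_smul_measure, charFun_smul_measure, charFun_conv, charFun_dirac,
        charFun_dirac, mul_left_comm, ← mul_assoc (Complex.exp _), ← Complex.exp_add]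
      simp
    rw [this, Measure.smul_apply, hμ, smul_zero]

lemma integral_exp_sub_one_sub_atom (b : SignedMeasure ℝ) (θ : ℝ) :
    ∫ᵛ x, (Complex.exp (Complex.I * θ * x) - 1)
        ∂<•(b - b {0} • (Measure.dirac (0 : ℝ)).toSignedMeasure)
      = ∫ᵛ x, (Complex.exp (Complex.I * θ * x) - 1) ∂<•b := by
  rw [VectorMeasure.integral_sub_vectorMeasure (integrable_exp_sub_one_vectorMeasure _ _)
    (integrable_exp_sub_one_vectorMeasure _ _), VectorMeasure.integral_smul_vectorMeasure,
    VectorMeasure.integral_toSignedMeasure]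
  simp

/-- A signed measure `b` for which `δ_c * exp(b)` is a measure on `[0, ∞)` is the quasi-Lévy
measure, up to an atom at the origin, of the normalised law. -/
lemma exists_law_of_isExp {c : ℝ} {b : SignedMeasure ℝ} {m : Measure ℝ} (hm : IsExp b m)
    (hc : (Measure.dirac c ∗ m) (Iio 0) = 0) :
    ∃ μ : Measure ℝ≥0, IsProbabilityMeasure μ ∧
      HasCharTriplet (μ.map ((↑) : ℝ≥0 → ℝ)) c 0
        (b - b {0} • (Measure.dirac (0 : ℝ)).toSignedMeasure) ∧
      ∀ θ : ℝ, charFun (μ.map ((↑) : ℝ≥0 → ℝ)) θ = Complex.exp (Complex.I * θ * c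
        + ∫ᵛ x, (Complex.exp (Complex.I * θ * x) - 1) ∂<•b) := by
  have := hm.1
  set r : ℝ≥0∞ := ENNReal.ofReal (Real.exp (-b univ)) with hr
  have hr' : r.toReal = Real.exp (-b univ) := ENNReal.toReal_ofReal (Real.exp_pos _).le
  set μ : Measure ℝ := r • (Measure.dirac c ∗ m) with hμ
  have hfin : IsFiniteMeasure μ := Measure.smul_finite _ ENNReal.ofReal_ne_top
  have hchar : ∀ θ : ℝ, charFun μ θ = Complex.exp (Complex.I * θ * c
      + ∫ᵛ x, (Complex.exp (Complex.I * θ * x) - 1) ∂<•b) := by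
    intro θ
    rw [charFun_smul_measure, charFun_conv, charFun_dirac, (isExp_iff b m).1 hm, hr']
    push_cast
    rw [← Complex.exp_add, ← Complex.exp_add]
    congr 1
    simp
    ring
  have hmap : (μ.map Real.toNNReal).map ((↑) : ℝ≥0 → ℝ) = μ := by
    rw [Measure.map_map measurable_coe_nnreal_real measurable_real_toNNReal]
    conv_rhs => rw [← Measure.map_id (μ := μ)]
    refine Measure.map_congr ?_
    have h0 : μ (Iio 0) = 0 := by rw [hμ, Measure.smul_apply, hc, smul_zero]
    filter_upwards [compl_mem_ae_iff.2 h0] with x hx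
    simpa using hx
  refine ⟨μ.map Real.toNNReal, ?_, ⟨?_, ?_⟩, ?_⟩
  · have h0 := hchar 0
    have : μ univ = 1 := by
      rw [charFun_zero] at h0
      have h1 : μ.real univ = 1 := by
        have : ((μ.real univ : ℝ) : ℂ) = 1 := by rw [h0]; simp
        exact_mod_cast this
      rwa [measureReal_def, ENNReal.toReal_eq_one_iff] at h1
    exact ⟨by rw [Measure.map_apply measurable_real_toNNReal .univ, preimage_univ, this]⟩
  · simp [Measure.toSignedMeasure_apply_measurable (measurableSet_singleton (0 : ℝ)),
      measureReal_def]
  · intro θ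
    rw [hmap, hchar, integral_exp_sub_one_sub_atom]
    simp
  · rw [hmap]
    exact hchar

/-! ### Null arrays -/

lemma norm_prod_sub_prod_le {ι : Type*} (s : Finset ι) (z w : ι → ℂ)
    (hz : ∀ i ∈ s, ‖z i‖ ≤ 1) (hw : ∀ i ∈ s, ‖w i‖ ≤ 1) :
    ‖∏ i ∈ s, z i - ∏ i ∈ s, w i‖ ≤ ∑ i ∈ s, ‖z i - w i‖ := by
  classical
  induction s using Finset.induction_on with
  | empty => simp
  | insert a s ha ih =>
    simp only [Finset.mem_insert, forall_eq_or_imp] at hz hw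
    rw [Finset.prod_insert ha, Finset.prod_insert ha, Finset.sum_insert ha,
      show z a * ∏ i ∈ s, z i - w a * ∏ i ∈ s, w i
        = (z a - w a) * ∏ i ∈ s, z i + w a * (∏ i ∈ s, z i - ∏ i ∈ s, w i) by ring]
    have h1 : ‖∏ i ∈ s, z i‖ ≤ 1 := by
      rw [norm_prod]
      exact Finset.prod_le_one (fun _ _ ↦ norm_nonneg _) hz.2
    refine (norm_add_le _ _).trans (add_le_add ?_ ?_)
    · rw [norm_mul]
      exact mul_le_of_le_one_right (norm_nonneg _) h1
    · rw [norm_mul]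
      exact (mul_le_of_le_one_left (norm_nonneg _) hw.1).trans (ih hz.2 hw.2)

lemma norm_exp_sub_one_le_one {z : ℂ} (hz : ‖z‖ ≤ 1) : ‖Complex.exp (z - 1)‖ ≤ 1 := by
  rw [Complex.norm_exp, Real.exp_le_one_iff]
  have := (Complex.re_le_norm z).trans hz
  simp only [Complex.sub_re, Complex.one_re]
  linarith

lemma norm_sub_exp_sub_one_le {z : ℂ} (hz : ‖z‖ ≤ 1) :
    ‖z - Complex.exp (z - 1)‖ ≤ 4 * ‖z - 1‖ ^ 2 := by
  rcases le_or_gt ‖z - 1‖ 1 with h | h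
  · have := Complex.norm_exp_sub_one_sub_id_le h
    rw [← norm_neg, show -(z - Complex.exp (z - 1)) = Complex.exp (z - 1) - 1 - (z - 1) by ring]
    nlinarith [sq_nonneg ‖z - 1‖]
  · have := (norm_sub_le z (Complex.exp (z - 1))).trans
      (add_le_add hz (norm_exp_sub_one_le_one hz))
    nlinarith

/-- The multiplicative comparison behind the Poisson approximation of a null array: numbers `z_i`
of the closed unit disc that are uniformly close to `1` satisfy `∏ z_i ≈ exp(∑ (z_i - 1))`. -/
lemma norm_prod_sub_exp_sum_le {ι : Type*} (s : Finset ι) (z : ι → ℂ) (hz : ∀ i ∈ s, ‖z i‖ ≤ 1) :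
    ‖∏ i ∈ s, z i - Complex.exp (∑ i ∈ s, (z i - 1))‖ ≤ 4 * ∑ i ∈ s, ‖z i - 1‖ ^ 2 := by
  rw [Complex.exp_sum, Finset.mul_sum]
  exact (norm_prod_sub_prod_le s _ _ hz fun i hi ↦ norm_exp_sub_one_le_one (hz i hi)).trans
    (Finset.sum_le_sum fun i hi ↦ norm_sub_exp_sub_one_le (hz i hi))

/-- The function `y ↦ min(1, y) / y` on `[0, ∞]`, equal to `1` at the origin. -/
def clipRatio (y : ℝ≥0∞) : ℝ≥0∞ := (max 1 y)⁻¹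

lemma clipRatio_le_one (y : ℝ≥0∞) : clipRatio y ≤ 1 := by
  simp [clipRatio]

lemma antitone_clipRatio : Antitone clipRatio := fun _ _ h ↦
  ENNReal.inv_le_inv.2 (max_le_max le_rfl h)

lemma continuous_clipRatio : Continuous clipRatio := by
  unfold clipRatio
  fun_prop

lemma clipRatio_zero : clipRatio 0 = 1 := by simp [clipRatio]

lemma clipRatio_mul_self {y : ℝ≥0∞} (hy : y ≠ ∞) : clipRatio y * y = min 1 y := by
  unfold clipRatio
  rcases le_total 1 y with h | h
  · rw [max_eq_right h, min_eq_left h, ENNReal.inv_mul_cancel (by positivity) hy]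
  · rw [max_eq_left h, min_eq_right h, inv_one, one_mul]

/-- The difference quotient `y ↦ (e^{iθy} - 1) / y`, with its limit `iθ` at the origin. -/
def charQuot (θ y : ℝ) : ℂ := dslope (fun y : ℝ ↦ Complex.exp (Complex.I * θ * y)) 0 y

lemma hasDerivAt_char (θ y : ℝ) : HasDerivAt (fun y : ℝ ↦ Complex.exp (Complex.I * θ * y))
    (Complex.exp (Complex.I * θ * y) * (Complex.I * θ)) y := by
  have h : HasDerivAt (fun y : ℂ ↦ Complex.exp (Complex.I * θ * y))
      (Complex.exp (Complex.I * θ * y) * (Complex.I * θ * 1)) (y : ℂ) :=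
    ((hasDerivAt_id (y : ℂ)).const_mul (Complex.I * θ)).cexp
  simpa using h.comp_ofReal

lemma continuous_charQuot (θ : ℝ) : Continuous (charQuot θ) := by
  have h : Differentiable ℝ (fun y : ℝ ↦ Complex.exp (Complex.I * θ * y)) :=
    fun y ↦ (hasDerivAt_char θ y).differentiableAt
  rw [← continuousOn_univ]
  exact (continuousOn_dslope Filter.univ_mem).2 ⟨h.continuous.continuousOn, h 0⟩

lemma charQuot_zero (θ : ℝ) : charQuot θ 0 = Complex.I * θ := by
  rw [charQuot, dslope_same, (hasDerivAt_char θ 0).deriv]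
  simp

lemma self_mul_charQuot (θ y : ℝ) : y * charQuot θ y = Complex.exp (Complex.I * θ * y) - 1 := by
  have := sub_smul_dslope (fun y : ℝ ↦ Complex.exp (Complex.I * θ * y)) 0 y
  simpa [charQuot] using this

lemma norm_exp_I_mul (θ y : ℝ) : ‖Complex.exp (Complex.I * θ * y)‖ = 1 := by
  rw [show Complex.I * θ * y = ((θ * y : ℝ) : ℂ) * Complex.I by push_cast; ring,
    Complex.norm_exp_ofReal_mul_I]

lemma norm_exp_I_mul_sub_one_le (θ y : ℝ) :
    ‖Complex.exp (Complex.I * θ * y) - 1‖ ≤ min 2 (|θ| * |y|) := by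
  refine le_min ?_ ?_
  · refine (norm_sub_le _ _).trans ?_
    rw [norm_exp_I_mul]
    norm_num
  · have := Real.norm_exp_I_mul_ofReal_sub_one_le (x := θ * y)
    rw [Real.norm_eq_abs, abs_mul] at this
    rwa [show Complex.I * θ * y = Complex.I * ((θ * y : ℝ) : ℂ) by push_cast; ring]

lemma enorm_exp_sub_one_le (θ : ℝ) {y : ℝ≥0∞} (hy : y ≠ ∞) :
    ‖Complex.exp (Complex.I * θ * (y.toReal : ℝ)) - 1‖ₑ ≤ ENNReal.ofReal (|θ| + 2) * min 1 y := by
  lift y to ℝ≥0 using hy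
  have h : min 1 (y : ℝ≥0∞) = ENNReal.ofReal (min 1 (y : ℝ)) := by
    rw [ENNReal.ofReal_min, ENNReal.ofReal_one, ENNReal.ofReal_coe_nnreal]
  rw [h, ← ENNReal.ofReal_mul (by positivity), ← ofReal_norm]
  refine ENNReal.ofReal_le_ofReal ((norm_exp_I_mul_sub_one_le θ _).trans ?_)
  have hy0 : (0 : ℝ) ≤ y := y.2
  rw [ENNReal.coe_toReal, abs_of_nonneg hy0]
  rcases le_total 1 (y : ℝ) with h | h
  · rw [min_eq_left h]
    exact (min_le_left _ _).trans (by linarith [abs_nonneg θ])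
  · rw [min_eq_right h]
    exact (min_le_right _ _).trans (by gcongr; linarith)

lemma enorm_charQuot_le (θ : ℝ) {y : ℝ≥0∞} (hy : y ≠ ∞) :
    ‖charQuot θ y.toReal‖ₑ ≤ ENNReal.ofReal (|θ| + 2) * clipRatio y := by
  rcases eq_or_ne y 0 with rfl | h0
  · rw [ENNReal.toReal_zero, charQuot_zero, clipRatio_zero, mul_one, ← ofReal_norm]
    refine ENNReal.ofReal_le_ofReal ?_
    simp
  · refine (ENNReal.mul_le_mul_iff_left h0 hy).1 ?_
    rw [mul_assoc, clipRatio_mul_self hy]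
    refine le_trans (le_of_eq ?_) (enorm_exp_sub_one_le θ hy)
    rw [← self_mul_charQuot, enorm_mul, mul_comm]
    congr 1
    rw [← ofReal_norm, Complex.norm_real, Real.norm_of_nonneg ENNReal.toReal_nonneg,
      ENNReal.ofReal_toReal hy]

/-- On a probability space `∑ E min(1, X_i)` is controlled by `-log E exp(-∑ X_i)` for independent
non-negative `X_i`. -/
lemma sum_lintegral_min_one_le {Ω ι : Type*} [MeasurableSpace Ω] [Fintype ι] {P : Measure Ω}
    [IsProbabilityMeasure P] {X : ι → Ω → ℝ≥0∞} (hX : ∀ i, Measurable (X i))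
    (hfin : ∀ i ω, X i ω ≠ ∞) (hind : iIndepFun X P) :
    ∑ i, ∫⁻ ω, min 1 (X i ω) ∂P ≤
      ENNReal.ofReal (-2 * Real.log (∫ ω, Real.exp (-(∑ i, X i ω).toReal) ∂P)) := by
  have hmeas : ∀ i, Measurable fun ω ↦ Real.exp (-(X i ω).toReal) := fun i ↦ by fun_prop
  have hbd : ∀ x : ℝ≥0∞, ‖Real.exp (-x.toReal)‖ ≤ 1 := fun x ↦ by
    simp [abs_of_pos (Real.exp_pos _)]
  have hint : ∀ i, Integrable (fun ω ↦ Real.exp (-(X i ω).toReal)) P := fun i ↦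
    Integrable.of_bound (C := 1) (hmeas i).aestronglyMeasurable (ae_of_all _ fun ω ↦ hbd _)
  have hprod : ∫ ω, Real.exp (-(∑ i, X i ω).toReal) ∂P
      = ∏ i, ∫ ω, Real.exp (-(X i ω).toReal) ∂P := by
    rw [← hind.integral_fun_prod_comp (f := fun _ x ↦ Real.exp (-x.toReal))
      (fun i ↦ (hX i).aemeasurable) (fun i ↦ by fun_prop)]
    refine integral_congr_ae (ae_of_all _ fun ω ↦ ?_)
    simp only
    rw [ENNReal.toReal_sum fun i _ ↦ hfin i ω, ← Finset.sum_neg_distrib, Real.exp_sum]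
  have hpos : ∀ i, 0 < ∫ ω, Real.exp (-(X i ω).toReal) ∂P := fun i ↦
    integral_exp_pos (hint i)
  rw [hprod, Real.log_prod fun i _ ↦ (hpos i).ne', Finset.mul_sum,
    ENNReal.ofReal_sum_of_nonneg]
  · refine Finset.sum_le_sum fun i _ ↦ ?_
    have h1 : ∀ ω, min 1 (X i ω) ≤ ENNReal.ofReal (2 * (1 - Real.exp (-(X i ω).toReal))) := by
      intro ω
      have hx := hfin i ω
      generalize X i ω = x at hx
      lift x to ℝ≥0 using hx
      have h : min 1 (x : ℝ≥0∞) = ENNReal.ofReal (min 1 (x : ℝ)) := by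
        rw [ENNReal.ofReal_min, ENNReal.ofReal_one, ENNReal.ofReal_coe_nnreal]
      rw [h, ENNReal.coe_toReal]
      refine ENNReal.ofReal_le_ofReal ?_
      have hx0 : (0 : ℝ) ≤ x := x.2
      -- `1 - e^{-x} ≥ x / (1 + x)`
      have h2 : Real.exp (-(x : ℝ)) ≤ (1 + (x : ℝ))⁻¹ := by
        rw [Real.exp_neg]
        exact inv_anti₀ (by positivity) (by linarith [Real.add_one_le_exp (x : ℝ)])
      have h3 : min 1 (x : ℝ) ≤ 2 * (1 - (1 + (x : ℝ))⁻¹) := by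
        have : 1 - (1 + (x : ℝ))⁻¹ = x / (1 + x) := by field_simp; ring
        rw [this, ← mul_div_assoc, le_div_iff₀ (by positivity)]
        rcases le_total 1 (x : ℝ) with h | h
        · rw [min_eq_left h]; linarith
        · rw [min_eq_right h]; nlinarith
      linarith
    refine (lintegral_mono h1).trans ?_
    rw [← ofReal_integral_eq_lintegral_ofReal]
    · refine ENNReal.ofReal_le_ofReal ?_
      rw [integral_const_mul, integral_sub (integrable_const _) (hint i)]
      simp only [integral_const, probReal_univ, smul_eq_mul, mul_one]
      have := Real.log_le_sub_one_of_pos (hpos i)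
      linarith
    · exact ((integrable_const _).sub (hint i)).const_mul _
    · refine ae_of_all _ fun ω ↦ ?_
      have : Real.exp (-(X i ω).toReal) ≤ 1 := by simp
      simp only [Pi.zero_apply]
      linarith
  · intro i _
    have : ∫ ω, Real.exp (-(X i ω).toReal) ∂P ≤ 1 := by
      calc _ ≤ ∫ _, (1 : ℝ) ∂P := integral_mono (hint i) (integrable_const _)
            fun ω ↦ by simp
        _ = 1 := by simp
    have := Real.log_nonpos (hpos i).le this
    linarith

/-! ### Nested finite partitions -/

section Cells

variable {S : Type*} [MeasurableSpace S] [MeasurableSpace.CountablyGenerated S]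

/-- The first `n` binary digits of a point in the standard coding of a countably generated space
by the Cantor space. -/
def cellIndex (n : ℕ) (x : S) (i : Fin n) : Bool := MeasurableSpace.mapNatBool S x i

/-- The cell of the `n`-th partition that contains `x`. -/
def cell (n : ℕ) (x : S) : Set S := {y | cellIndex n y = cellIndex n x}

lemma measurable_cellIndex (n : ℕ) : Measurable (cellIndex (S := S) n) :=
  measurable_pi_lambda _ fun i ↦
    (measurable_pi_apply (i : ℕ)).comp (MeasurableSpace.measurable_mapNatBool (α := S))

lemma measurableSet_cellIndex_eq (n : ℕ) (w : Fin n → Bool) :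
    MeasurableSet {x : S | cellIndex n x = w} :=
  measurable_cellIndex n (measurableSet_singleton w)

lemma measurableSet_cell (n : ℕ) (x : S) : MeasurableSet (cell n x) :=
  measurableSet_cellIndex_eq n _

lemma mem_cell_self (n : ℕ) (x : S) : x ∈ cell n x := rfl

lemma antitone_cell (x : S) : Antitone fun n ↦ cell n x := by
  intro m n hmn y hy
  funext i
  exact congrFun hy (Fin.castLE hmn i)

lemma iInter_cell [MeasurableSpace.SeparatesPoints S] (x : S) : ⋂ n, cell n x = {x} := by
  refine Subset.antisymm (fun y hy ↦ ?_) (by simp [mem_cell_self])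
  refine MeasurableSpace.injective_mapNatBool (α := S) (funext fun n ↦ ?_)
  exact congrFun (mem_iInter.1 hy (n + 1)) (Fin.last n)

lemma measurableSet_mem_cell (n : ℕ) : MeasurableSet {p : S × S | p.2 ∈ cell n p.1} :=
  measurableSet_eq_fun ((measurable_cellIndex n).comp measurable_snd)
    ((measurable_cellIndex n).comp measurable_fst)

lemma tendsto_measure_inter_cell [MeasurableSpace.SeparatesPoints S] (μ : Measure S)
    [IsFiniteMeasure μ] {A : Set S} (hA : MeasurableSet A) {x : S} (hx : x ∈ A) :
    Filter.Tendsto (fun n ↦ μ (A ∩ cell n x)) Filter.atTop (nhds (μ {x})) := by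
  have h : {x} = ⋂ n, A ∩ cell n x := by
    rw [← inter_iInter, iInter_cell, eq_comm, inter_eq_right]
    simpa using hx
  rw [h]
  exact tendsto_measure_iInter_atTop
    (fun n ↦ (hA.inter (measurableSet_cell n x)).nullMeasurableSet)
    (fun m n hmn ↦ inter_subset_inter_right A (antitone_cell x hmn)) ⟨0, measure_ne_top _ _⟩

end Cells

/-! ### Refining sums over the cells of a random measure -/

section NullArray

variable {S : Type*} [MeasurableSpace S] {Ω : Type*} [MeasurableSpace Ω] {P : Measure Ω}
  {κ : Kernel Ω S}

/-- The function dominating the difference quotients along the partitions. -/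
def charQuotBound (κ : Kernel Ω S) (θ : ℝ) (p : Ω × S) : ℝ :=
  (ENNReal.ofReal (|θ| + 2) * clipRatio (κ p.1 {p.2})).toReal

lemma norm_charQuot_le_charQuotBound [∀ ω, IsFiniteMeasure (κ ω)] (θ : ℝ) {y : ℝ≥0∞}
    (hy : y ≠ ∞) {p : Ω × S} (hp : κ p.1 {p.2} ≤ y) :
    ‖charQuot θ y.toReal‖ ≤ charQuotBound κ θ p := by
  rw [charQuotBound, ← toReal_enorm]
  refine ENNReal.toReal_mono (ENNReal.mul_ne_top ENNReal.ofReal_ne_top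
    ((clipRatio_le_one _).trans_lt ENNReal.one_lt_top).ne) ((enorm_charQuot_le θ hy).trans ?_)
  gcongr
  exact antitone_clipRatio hp

variable [MeasurableSpace.CountablyGenerated S] [IsSFiniteKernel κ]

/-- The trace on `A` of the cell of the `n`-th partition with index `w`. -/
def cellTrace (A : Set S) (n : ℕ) (w : Fin n → Bool) : Set S := A ∩ {x | cellIndex n x = w}

lemma measurableSet_cellTrace {A : Set S} (hA : MeasurableSet A) (n : ℕ) (w : Fin n → Bool) :
    MeasurableSet (cellTrace A n w) :=
  hA.inter (measurableSet_cellIndex_eq n w)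

lemma inter_cell_of_mem_cellTrace {A : Set S} {n : ℕ} {w : Fin n → Bool} {x : S}
    (hx : x ∈ cellTrace A n w) : A ∩ cell n x = cellTrace A n w := by
  rw [cellTrace, ← hx.2]
  rfl

lemma pairwise_disjoint_cellTrace (A : Set S) (n : ℕ) :
    Pairwise fun w w' ↦ Disjoint (cellTrace A n w) (cellTrace A n w') := by
  intro w w' h
  rw [Set.disjoint_left]
  rintro x ⟨-, rfl⟩ ⟨-, h'⟩
  exact h h'

lemma iUnion_cellTrace (A : Set S) (n : ℕ) : ⋃ w, cellTrace A n w = A := by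
  ext x
  simp [cellTrace]

variable (κ) in
lemma measurable_measure_inter_cell {A : Set S} (hA : MeasurableSet A) (n : ℕ) :
    Measurable fun p : Ω × S ↦ κ p.1 (A ∩ cell n p.2) := by
  have h : MeasurableSet {q : (Ω × S) × S | q.2 ∈ A ∩ cell n q.1.2} :=
    (measurable_snd hA).inter
      (((measurable_snd.comp measurable_fst).prodMk measurable_snd) (measurableSet_mem_cell n))
  exact Kernel.measurable_kernel_prodMk_left (κ := Kernel.prodMkRight S κ) h

variable (κ) in
lemma measurable_atomMass [MeasurableSpace.SeparatesPoints S] [∀ ω, IsFiniteMeasure (κ ω)] :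
    Measurable fun p : Ω × S ↦ κ p.1 {p.2} := by
  refine measurable_of_tendsto_metrizable
    (fun n ↦ measurable_measure_inter_cell κ MeasurableSet.univ n) ?_
  rw [tendsto_pi_nhds]
  exact fun p ↦ tendsto_measure_inter_cell (κ p.1) .univ (mem_univ p.2)

lemma integrable_charQuotBound [MeasurableSpace.SeparatesPoints S]
    [∀ ω, IsFiniteMeasure (κ ω)] (hQ : ∫⁻ p, clipRatio (κ p.1 {p.2}) ∂(P ⊗ₘ κ) < ∞) (θ : ℝ) :
    Integrable (charQuotBound κ θ) (P ⊗ₘ κ) := by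
  have hm : Measurable fun p : Ω × S ↦ clipRatio (κ p.1 {p.2}) :=
    continuous_clipRatio.measurable.comp (measurable_atomMass κ)
  refine integrable_toReal_of_lintegral_ne_top (hm.const_mul _).aemeasurable ?_
  rw [lintegral_const_mul _ hm]
  exact ENNReal.mul_ne_top ENNReal.ofReal_ne_top hQ.ne

lemma measure_singleton_le_inter_cell (μ : Measure S) {A : Set S} {x : S} (hx : x ∈ A) (n : ℕ) :
    μ {x} ≤ μ (A ∩ cell n x) :=
  measure_mono (by simpa using ⟨hx, mem_cell_self n x⟩)

variable (κ) in
lemma measurable_charQuot_inter_cell {A : Set S} (hA : MeasurableSet A) (θ : ℝ) (n : ℕ) :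
    Measurable fun p : Ω × S ↦ charQuot θ (κ p.1 (A ∩ cell n p.2)).toReal :=
  (continuous_charQuot θ).measurable.comp (measurable_measure_inter_cell κ hA n).ennreal_toReal

lemma integrableOn_charQuot_inter_cell [MeasurableSpace.SeparatesPoints S]
    [∀ ω, IsFiniteMeasure (κ ω)] (hQ : ∫⁻ p, clipRatio (κ p.1 {p.2}) ∂(P ⊗ₘ κ) < ∞)
    {A : Set S} (hA : MeasurableSet A) (θ : ℝ) (n : ℕ) :
    IntegrableOn (fun p : Ω × S ↦ charQuot θ (κ p.1 (A ∩ cell n p.2)).toReal) (univ ×ˢ A)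
      (P ⊗ₘ κ) := by
  refine Integrable.mono' (integrable_charQuotBound hQ θ).integrableOn
    (measurable_charQuot_inter_cell κ hA θ n).aestronglyMeasurable ?_
  filter_upwards [ae_restrict_mem (MeasurableSet.univ.prod hA)] with p hp
  exact norm_charQuot_le_charQuotBound θ (measure_ne_top _ _)
    (measure_singleton_le_inter_cell _ hp.2 n)

variable [IsProbabilityMeasure P]

/-- The map `x ↦ κ(ω, A ∩ cell n x)` is constant on each trace of a cell, so that integrating a
difference quotient against `κ(ω, dx)` recovers the function itself. -/
lemma lintegral_min_one_cellTrace [∀ ω, IsFiniteMeasure (κ ω)] {A : Set S} (hA : MeasurableSet A)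
    (n : ℕ) (w : Fin n → Bool) {c : ℝ≥0∞} :
    ∫⁻ p in univ ×ˢ cellTrace A n w, clipRatio (κ p.1 (A ∩ cell n p.2)) * c ∂(P ⊗ₘ κ)
      = (∫⁻ ω, min 1 (κ ω (cellTrace A n w)) ∂P) * c := by
  have hm : Measurable fun p : Ω × S ↦ clipRatio (κ p.1 (A ∩ cell n p.2)) :=
    continuous_clipRatio.measurable.comp (measurable_measure_inter_cell κ hA n)
  have hm' : Measurable fun ω ↦ min 1 (κ ω (cellTrace A n w)) :=
    measurable_const.min (κ.measurable_coe (measurableSet_cellTrace hA n w))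
  rw [Measure.setLIntegral_compProd (hm.mul_const c) .univ (measurableSet_cellTrace hA n w),
    Measure.restrict_univ, ← lintegral_mul_const _ hm']
  refine lintegral_congr fun ω ↦ ?_
  rw [setLIntegral_congr_fun (g := fun _ ↦ clipRatio (κ ω (cellTrace A n w)) * c)
    (measurableSet_cellTrace hA n w) fun x hx ↦ by
      simp only [inter_cell_of_mem_cellTrace hx]]
  rw [setLIntegral_const, mul_right_comm, clipRatio_mul_self (measure_ne_top _ _)]

lemma setLIntegral_eq_sum_cellTrace {A : Set S} (hA : MeasurableSet A) (n : ℕ)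
    (f : Ω × S → ℝ≥0∞) (Q : Measure (Ω × S)) :
    ∫⁻ p in univ ×ˢ A, f p ∂Q = ∑ w, ∫⁻ p in univ ×ˢ cellTrace A n w, f p ∂Q := by
  conv_lhs => rw [← iUnion_cellTrace A n, prod_iUnion]
  rw [lintegral_iUnion (fun w ↦ MeasurableSet.univ.prod (measurableSet_cellTrace hA n w)),
    tsum_fintype]
  exact fun w w' h ↦ Disjoint.set_prod_right (pairwise_disjoint_cellTrace A n h) _ _

/-- Complete randomness gives a bound, uniform along the partitions, for the truncated means of
the masses of the cells; by Fatou's lemma it passes to the limit, in which only the diffuse part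
and the atoms remain. -/
lemma lintegral_clipRatio_atomMass_lt_top [MeasurableSpace.SeparatesPoints S]
    [∀ ω, IsFiniteMeasure (κ ω)]
    (hind : ∀ n, iIndepFun (fun (w : Fin n → Bool) ω ↦ κ ω (cellTrace univ n w)) P) :
    ∫⁻ p, clipRatio (κ p.1 {p.2}) ∂(P ⊗ₘ κ) < ∞ := by
  have hb : ∀ n, ∫⁻ p, clipRatio (κ p.1 (univ ∩ cell n p.2)) ∂(P ⊗ₘ κ)
      ≤ ENNReal.ofReal (-2 * Real.log (∫ ω, Real.exp (-(κ ω univ).toReal) ∂P)) := by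
    intro n
    have h1 := sum_lintegral_min_one_le
      (fun w ↦ κ.measurable_coe (measurableSet_cellTrace MeasurableSet.univ n w))
      (fun w ω ↦ measure_ne_top _ _) (hind n)
    have h2 : ∀ ω, ∑ w, κ ω (cellTrace univ n w) = κ ω univ := by
      intro ω
      conv_rhs => rw [← iUnion_cellTrace univ n]
      rw [measure_iUnion (pairwise_disjoint_cellTrace univ n)
        (measurableSet_cellTrace MeasurableSet.univ n), tsum_fintype]
    simp only [h2] at h1
    refine le_trans (le_of_eq ?_) h1
    rw [← setLIntegral_univ, ← univ_prod_univ, setLIntegral_eq_sum_cellTrace MeasurableSet.univ n]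
    refine Finset.sum_congr rfl fun w _ ↦ ?_
    have := lintegral_min_one_cellTrace (P := P) (κ := κ) MeasurableSet.univ n w (c := 1)
    simpa only [mul_one] using this
  refine lt_of_le_of_lt ?_ (ENNReal.ofReal_lt_top
    (r := -2 * Real.log (∫ ω, Real.exp (-(κ ω univ).toReal) ∂P)))
  calc ∫⁻ p, clipRatio (κ p.1 {p.2}) ∂(P ⊗ₘ κ)
      = ∫⁻ p, Filter.liminf (fun n ↦ clipRatio (κ p.1 (univ ∩ cell n p.2))) Filter.atTop
          ∂(P ⊗ₘ κ) := by
        refine lintegral_congr fun p ↦ ?_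
        exact ((continuous_clipRatio.tendsto _).comp
          (tendsto_measure_inter_cell (κ p.1) .univ (mem_univ p.2))).liminf_eq.symm
    _ ≤ Filter.liminf (fun n ↦ ∫⁻ p, clipRatio (κ p.1 (univ ∩ cell n p.2)) ∂(P ⊗ₘ κ))
          Filter.atTop :=
        lintegral_liminf_le fun n ↦ continuous_clipRatio.measurable.comp
          (measurable_measure_inter_cell κ MeasurableSet.univ n)
    _ ≤ _ := Filter.liminf_le_of_le (by isBoundedDefault) fun b hb' ↦ by
        obtain ⟨n, hn⟩ := hb'.exists
        exact hn.trans (hb n)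

/-- In the absence of fixed atoms, the masses of the cells form a null array. -/
lemma tendsto_sum_lintegral_min_one_sq [MeasurableSpace.SeparatesPoints S]
    [∀ ω, IsFiniteMeasure (κ ω)] (hQ : ∫⁻ p, clipRatio (κ p.1 {p.2}) ∂(P ⊗ₘ κ) < ∞)
    (hatom : ∀ s : S, ∀ᵐ ω ∂P, κ ω {s} = 0) {A : Set S} (hA : MeasurableSet A) :
    Filter.Tendsto (fun n ↦ ∑ w, (∫⁻ ω, min 1 (κ ω (cellTrace A n w)) ∂P) ^ 2)
      Filter.atTop (nhds 0) := by
  set r : ℕ → S → ℝ≥0∞ := fun n x ↦ ∫⁻ ω, min 1 (κ ω (A ∩ cell n x)) ∂P with hr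
  have hrm : ∀ n, Measurable (r n) := fun n ↦
    (measurable_const.min (measurable_measure_inter_cell κ hA n)).lintegral_prod_left'
  have hr1 : ∀ n x, r n x ≤ 1 := fun n x ↦ by
    calc r n x ≤ ∫⁻ _, 1 ∂P := lintegral_mono fun ω ↦ min_le_left _ _
      _ = 1 := by simp
  have hr0 : ∀ x ∈ A, Filter.Tendsto (fun n ↦ r n x) Filter.atTop (nhds 0) := by
    intro x hx
    have h := tendsto_lintegral_of_dominated_convergence (μ := P)
      (F := fun n ω ↦ min 1 (κ ω (A ∩ cell n x))) (f := fun _ ↦ 0) (fun _ ↦ 1)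
      (fun n ↦ measurable_const.min
        (κ.measurable_coe (hA.inter (measurableSet_cell n x))))
      (fun n ↦ ae_of_all _ fun ω ↦ min_le_left _ _) (by simp) ?_
    · simpa using h
    · filter_upwards [hatom x] with ω hω
      have := (tendsto_const_nhds (x := (1 : ℝ≥0∞))).min (tendsto_measure_inter_cell (κ ω) hA hx)
      simpa [hω] using this
  have hsum : ∀ n, ∑ w, (∫⁻ ω, min 1 (κ ω (cellTrace A n w)) ∂P) ^ 2
      = ∫⁻ p in univ ×ˢ A, clipRatio (κ p.1 (A ∩ cell n p.2)) * r n p.2 ∂(P ⊗ₘ κ) := by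
    intro n
    rw [setLIntegral_eq_sum_cellTrace hA n]
    refine Finset.sum_congr rfl fun w _ ↦ ?_
    rw [sq, ← lintegral_min_one_cellTrace hA]
    refine setLIntegral_congr_fun (MeasurableSet.univ.prod (measurableSet_cellTrace hA n w))
      fun p hp ↦ ?_
    simp only [hr, inter_cell_of_mem_cellTrace hp.2]
  simp only [hsum]
  have h := tendsto_lintegral_of_dominated_convergence (μ := (P ⊗ₘ κ).restrict (univ ×ˢ A))
      (F := fun n p ↦ clipRatio (κ p.1 (A ∩ cell n p.2)) * r n p.2) (f := fun _ ↦ 0)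
      (fun p ↦ clipRatio (κ p.1 {p.2}))
      (fun n ↦ (continuous_clipRatio.measurable.comp
        (measurable_measure_inter_cell κ hA n)).mul ((hrm n).comp measurable_snd))
      ?_ ((setLIntegral_le_lintegral _ _).trans_lt hQ).ne ?_
  · simpa using h
  · intro n
    filter_upwards [ae_restrict_mem (MeasurableSet.univ.prod hA)] with p hp
    exact (mul_le_of_le_one_right' (hr1 n p.2)).trans
      (antitone_clipRatio (measure_singleton_le_inter_cell _ hp.2 n))
  · filter_upwards [ae_restrict_mem (MeasurableSet.univ.prod hA)] with p hp
    have h1 := (continuous_clipRatio.tendsto _).comp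
      (tendsto_measure_inter_cell (κ p.1) hA hp.2)
    have h2 := ENNReal.Tendsto.mul h1 (Or.inr ENNReal.zero_ne_top) (hr0 p.2 hp.2)
      (Or.inr ((clipRatio_le_one _).trans_lt ENNReal.one_lt_top).ne)
    simpa using h2

lemma integral_exp_sub_one_cellTrace [MeasurableSpace.SeparatesPoints S]
    [∀ ω, IsFiniteMeasure (κ ω)] (hQ : ∫⁻ p, clipRatio (κ p.1 {p.2}) ∂(P ⊗ₘ κ) < ∞)
    {A : Set S} (hA : MeasurableSet A) (θ : ℝ) (n : ℕ) (w : Fin n → Bool) :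
    ∫ p in univ ×ˢ cellTrace A n w, charQuot θ (κ p.1 (A ∩ cell n p.2)).toReal ∂(P ⊗ₘ κ)
      = ∫ ω, (Complex.exp (Complex.I * θ * ((κ ω (cellTrace A n w)).toReal : ℝ)) - 1) ∂P := by
  rw [Measure.setIntegral_compProd .univ (measurableSet_cellTrace hA n w)
    ((integrableOn_charQuot_inter_cell hQ hA θ n).mono_set
      (prod_mono le_rfl inter_subset_left)), Measure.restrict_univ]
  refine integral_congr_ae (ae_of_all _ fun ω ↦ ?_)
  simp only
  rw [setIntegral_congr_fun (g := fun _ ↦ charQuot θ (κ ω (cellTrace A n w)).toReal)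
    (measurableSet_cellTrace hA n w) fun x hx ↦ by
      simp only [inter_cell_of_mem_cellTrace hx], setIntegral_const, ← self_mul_charQuot,
    Complex.real_smul, measureReal_def]

/-- The expectation of the sums `∑_w (e^{iθ κ(A_w)} - 1)` over the cells converges. -/
lemma tendsto_sum_integral_exp_sub_one [MeasurableSpace.SeparatesPoints S]
    [∀ ω, IsFiniteMeasure (κ ω)] (hQ : ∫⁻ p, clipRatio (κ p.1 {p.2}) ∂(P ⊗ₘ κ) < ∞)
    {A : Set S} (hA : MeasurableSet A) (θ : ℝ) :
    Filter.Tendsto (fun n ↦ ∑ w, ∫ ω,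
        (Complex.exp (Complex.I * θ * ((κ ω (cellTrace A n w)).toReal : ℝ)) - 1) ∂P)
      Filter.atTop
      (nhds (∫ p in univ ×ˢ A, charQuot θ (κ p.1 {p.2}).toReal ∂(P ⊗ₘ κ))) := by
  have hsum : ∀ n, ∑ w, ∫ ω,
        (Complex.exp (Complex.I * θ * ((κ ω (cellTrace A n w)).toReal : ℝ)) - 1) ∂P
      = ∫ p in univ ×ˢ A, charQuot θ (κ p.1 (A ∩ cell n p.2)).toReal ∂(P ⊗ₘ κ) := by
    intro n
    simp only [← integral_exp_sub_one_cellTrace hQ hA]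
    rw [← integral_iUnion_fintype
      (fun w ↦ MeasurableSet.univ.prod (measurableSet_cellTrace hA n w))
      (fun w w' h ↦ Disjoint.set_prod_right (pairwise_disjoint_cellTrace A n h) _ _)
      fun w ↦ (integrableOn_charQuot_inter_cell hQ hA θ n).mono_set
        (prod_mono le_rfl inter_subset_left)]
    rw [← prod_iUnion, iUnion_cellTrace]
  simp only [hsum]
  refine tendsto_integral_of_dominated_convergence (charQuotBound κ θ)
    (fun n ↦ (measurable_charQuot_inter_cell κ hA θ n).aestronglyMeasurable)
    (integrable_charQuotBound hQ θ).integrableOn (fun n ↦ ?_) ?_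
  · filter_upwards [ae_restrict_mem (MeasurableSet.univ.prod hA)] with p hp
    exact norm_charQuot_le_charQuotBound θ (measure_ne_top _ _)
      (measure_singleton_le_inter_cell _ hp.2 n)
  · filter_upwards [ae_restrict_mem (MeasurableSet.univ.prod hA)] with p hp
    exact ((continuous_charQuot θ).tendsto _).comp
      ((ENNReal.tendsto_toReal (measure_ne_top _ _)).comp
        (tendsto_measure_inter_cell (κ p.1) hA hp.2))

/-- The characteristic function of a completely random measure without fixed atoms: the values on
the cells form a null array of independent variables. -/
theorem integral_exp_eq_exp_integral_charQuot [MeasurableSpace.SeparatesPoints S]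
    [∀ ω, IsFiniteMeasure (κ ω)] (hQ : ∫⁻ p, clipRatio (κ p.1 {p.2}) ∂(P ⊗ₘ κ) < ∞)
    (hatom : ∀ s : S, ∀ᵐ ω ∂P, κ ω {s} = 0) {A : Set S} (hA : MeasurableSet A)
    (hind : ∀ n, iIndepFun (fun (w : Fin n → Bool) ω ↦ κ ω (cellTrace A n w)) P) (θ : ℝ) :
    ∫ ω, Complex.exp (Complex.I * θ * ((κ ω A).toReal : ℝ)) ∂P =
      Complex.exp (∫ p in univ ×ˢ A, charQuot θ (κ p.1 {p.2}).toReal ∂(P ⊗ₘ κ)) := by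
  have hmeas : ∀ n w, Measurable fun ω ↦ κ ω (cellTrace A n w) := fun n w ↦
    κ.measurable_coe (measurableSet_cellTrace hA n w)
  have hint : ∀ n w, Integrable (fun ω ↦
      Complex.exp (Complex.I * θ * ((κ ω (cellTrace A n w)).toReal : ℝ))) P := by
    intro n w
    have := hmeas n w
    exact Integrable.of_bound (C := 1) (Measurable.aestronglyMeasurable (by fun_prop))
      (ae_of_all _ fun ω ↦ (norm_exp_I_mul _ _).le)
  set z : (n : ℕ) → (Fin n → Bool) → ℂ := fun n w ↦
    ∫ ω, Complex.exp (Complex.I * θ * ((κ ω (cellTrace A n w)).toReal : ℝ)) ∂P with hz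
  have hz1 : ∀ n w, ‖z n w‖ ≤ 1 := by
    intro n w
    refine (norm_integral_le_integral_norm _).trans ?_
    simp only [norm_exp_I_mul]
    simp
  have hzsub : ∀ n w, z n w - 1 = ∫ ω,
      (Complex.exp (Complex.I * θ * ((κ ω (cellTrace A n w)).toReal : ℝ)) - 1) ∂P := by
    intro n w
    rw [integral_sub (hint n w) (integrable_const _)]
    simp [hz]
  have hprod : ∀ n, ∫ ω, Complex.exp (Complex.I * θ * ((κ ω A).toReal : ℝ)) ∂P
      = ∏ w, z n w := by
    intro n
    rw [← (hind n).integral_fun_prod_comp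
      (f := fun _ (x : ℝ≥0∞) ↦ Complex.exp (Complex.I * θ * (x.toReal : ℝ)))
      (fun w ↦ (hmeas n w).aemeasurable)
      (fun w ↦ Measurable.aestronglyMeasurable (by fun_prop))]
    refine integral_congr_ae (ae_of_all _ fun ω ↦ ?_)
    have h : κ ω A = ∑ w, κ ω (cellTrace A n w) := by
      conv_lhs => rw [← iUnion_cellTrace A n]
      rw [measure_iUnion (pairwise_disjoint_cellTrace A n) (measurableSet_cellTrace hA n),
        tsum_fintype]
    simp only
    rw [h, ENNReal.toReal_sum fun _ _ ↦ measure_ne_top _ _, ← Complex.exp_sum]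
    push_cast
    rw [Finset.mul_sum]
  have herr : Filter.Tendsto (fun n ↦ 4 * ∑ w, ‖z n w - 1‖ ^ 2) Filter.atTop (nhds 0) := by
    have h := ((ENNReal.tendsto_toReal ENNReal.zero_ne_top).comp
      (tendsto_sum_lintegral_min_one_sq (P := P) hQ hatom hA)).const_mul (4 * (|θ| + 2) ^ 2)
    rw [ENNReal.toReal_zero, mul_zero] at h
    refine squeeze_zero (fun n ↦ by positivity) (fun n ↦ ?_) h
    have hle1 : ∀ w, ∫⁻ ω, min 1 (κ ω (cellTrace A n w)) ∂P ≤ 1 := fun w ↦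
      calc _ ≤ ∫⁻ _, 1 ∂P := lintegral_mono fun ω ↦ min_le_left _ _
        _ = 1 := by simp
    have htop : ∀ w, ∫⁻ ω, min 1 (κ ω (cellTrace A n w)) ∂P ≠ ∞ := fun w ↦
      ((hle1 w).trans_lt ENNReal.one_lt_top).ne
    rw [Function.comp_apply, ENNReal.toReal_sum fun w _ ↦ ENNReal.pow_ne_top (htop w), mul_assoc,
      Finset.mul_sum _ _ ((|θ| + 2) ^ 2)]
    refine mul_le_mul_of_nonneg_left (Finset.sum_le_sum fun w _ ↦ ?_) (by norm_num)
    rw [ENNReal.toReal_pow, ← mul_pow]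
    refine pow_le_pow_left₀ (norm_nonneg _) ?_ 2
    have : ‖z n w - 1‖ₑ ≤
        ENNReal.ofReal (|θ| + 2) * ∫⁻ ω, min 1 (κ ω (cellTrace A n w)) ∂P := by
      rw [hzsub, ← lintegral_const_mul _ (measurable_const.min (hmeas n w))]
      exact (enorm_integral_le_lintegral_enorm _).trans
        (lintegral_mono fun ω ↦ enorm_exp_sub_one_le θ (measure_ne_top _ _))
    have h3 := ENNReal.toReal_mono (ENNReal.mul_ne_top ENNReal.ofReal_ne_top (htop w)) this
    rwa [toReal_enorm, ENNReal.toReal_mul, ENNReal.toReal_ofReal (by positivity)] at h3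
  have hlim : Filter.Tendsto (fun n ↦ Complex.exp (∑ w, (z n w - 1))) Filter.atTop
      (nhds (∫ ω, Complex.exp (Complex.I * θ * ((κ ω A).toReal : ℝ)) ∂P)) := by
    rw [tendsto_iff_norm_sub_tendsto_zero]
    refine squeeze_zero (fun n ↦ norm_nonneg _) (fun n ↦ ?_) herr
    rw [hprod n, norm_sub_rev]
    exact norm_prod_sub_exp_sum_le _ _ fun w _ ↦ hz1 n w
  refine tendsto_nhds_unique hlim ?_
  simp only [hzsub]
  exact (Complex.continuous_exp.tendsto _).comp (tendsto_sum_integral_exp_sub_one hQ hA θ)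

end NullArray

/-! ### Atomless completely random measures -/

section Atomless

variable {S : Type*} [MeasurableSpace S] [MeasurableSpace.CountablyGenerated S]
  [MeasurableSpace.SeparatesPoints S] [MeasurableSingletonClass S]
  {Ω : Type*} [MeasurableSpace Ω] {P : Measure Ω}

/-- A measurable family of measures, cut off where the total mass is infinite, is an s-finite
kernel. -/
lemma exists_sFiniteKernel {S : Type*} [MeasurableSpace S] {α : Ω → Measure S}
    (hα : Measurable α) :
    ∃ κ : Kernel Ω S, IsSFiniteKernel κ ∧ (∀ ω, IsFiniteMeasure (κ ω)) ∧
      ∀ ω, α ω univ < ∞ → κ ω = α ω := by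
  classical
  have hT : Measurable fun ω ↦ α ω univ := (Measure.measurable_coe .univ).comp hα
  set s : ℕ → Set Ω := fun n ↦ {ω | α ω univ ≠ ∞ ∧ ⌊(α ω univ).toReal⌋₊ = n} with hs
  have hsm : ∀ n, MeasurableSet (s n) := fun n ↦
    ((measurableSet_eq_fun hT measurable_const).compl).inter
      (measurableSet_eq_fun (Nat.measurable_floor.comp hT.ennreal_toReal) measurable_const)
  set κ : ℕ → Kernel Ω S := fun n ↦ Kernel.piecewise (hsm n) ⟨α, hα⟩ 0 with hκ
  have hfin : ∀ n, IsFiniteKernel (κ n) := by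
    refine fun n ↦ ⟨⟨n + 1, by finiteness, fun ω ↦ ?_⟩⟩
    rw [hκ, Kernel.piecewise_apply']
    split_ifs with h
    · have h1 := Nat.lt_floor_add_one (α ω univ).toReal
      rw [h.2] at h1
      calc α ω univ = ENNReal.ofReal (α ω univ).toReal := (ENNReal.ofReal_toReal h.1).symm
        _ ≤ ENNReal.ofReal (n + 1) := ENNReal.ofReal_le_ofReal h1.le
        _ = n + 1 := by
          rw [ENNReal.ofReal_add (by positivity) (by positivity)]
          simp
    · simp
  have happ : ∀ ω, Kernel.sum κ ω = if α ω univ = ∞ then 0 else α ω := by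
    intro ω
    ext B hB
    rw [Kernel.sum_apply' _ _ hB, tsum_eq_single ⌊(α ω univ).toReal⌋₊]
    · rw [hκ, Kernel.piecewise_apply']
      by_cases h : α ω univ = ∞
      · simp [h, hs]
      · simp [h, hs]
    · intro n hn
      rw [hκ, Kernel.piecewise_apply', if_neg fun h ↦ hn h.2.symm]
      rfl
  refine ⟨Kernel.sum κ, inferInstance, fun ω ↦ ?_, fun ω hω ↦ by rw [happ, if_neg hω.ne]⟩
  rw [happ]
  split_ifs with h
  · infer_instance
  · exact ⟨lt_top_iff_ne_top.2 h⟩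

/-- The integral of the inverse atom masses counts the atoms. -/
lemma lintegral_inv_atomMass_le {S : Type*} [MeasurableSpace S] [MeasurableSingletonClass S]
    (μ : Measure S) [IsFiniteMeasure μ] :
    ∫⁻ x in {x | μ {x} ≠ 0}, (μ {x})⁻¹ ∂μ
      ≤ Measure.sum (fun s : {s : S // μ {s} ≠ 0} ↦
          Measure.dirac (s.1, (μ {s.1}).toReal)) (univ : Set (S × ℝ)) := by
  have hc : {x | μ {x} ≠ 0}.Countable := by
    have := Measure.countable_meas_pos_of_disjoint_iUnion (μ := μ) (As := fun x : S ↦ {x})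
      (fun x ↦ measurableSet_singleton x) (fun x y h ↦ by simpa using h)
    simpa only [pos_iff_ne_zero] using this
  rw [lintegral_countable _ hc, Measure.sum_apply _ .univ]
  refine ENNReal.tsum_le_tsum fun x ↦ ?_
  rw [ENNReal.inv_mul_cancel x.2 (measure_ne_top _ _)]
  simp

variable [IsProbabilityMeasure P]

/-- The jumps and the diffuse part of a random measure without fixed atoms: the mean measures
`γ` of the diffuse part and `G` of the jump process represent the integral of the difference
quotients of the character. -/
lemma exists_measures_of_kernel {κ : Kernel Ω S} [IsSFiniteKernel κ]
    [∀ ω, IsFiniteMeasure (κ ω)] (hQ : ∫⁻ p, clipRatio (κ p.1 {p.2}) ∂(P ⊗ₘ κ) < ∞)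
    (hatom : ∀ s : S, ∀ᵐ ω ∂P, κ ω {s} = 0)
    (hlevy : ∫⁻ ω, ∫⁻ x in {x | κ ω {x} ≠ 0}, (κ ω {x})⁻¹ ∂(κ ω) ∂P < ∞) :
    ∃ (γ : Measure S) (G : Measure (S × Ioi (0 : ℝ))),
      IsFiniteMeasure γ ∧ (∀ x : S, γ {x} = 0) ∧ IsFiniteMeasure G ∧
      (∀ B : Set (Ioi (0 : ℝ)), MeasurableSet B → ∀ x : S, G ({x} ×ˢ B) = 0) ∧
      ∀ A : Set S, MeasurableSet A → ∀ θ : ℝ,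
        ∫ p in univ ×ˢ A, charQuot θ (κ p.1 {p.2}).toReal ∂(P ⊗ₘ κ)
          = Complex.I * θ * (γ.real A : ℝ) + ∫ q in A ×ˢ (univ : Set ℝ),
            (Complex.exp (Complex.I * θ * q.2) - 1)
              ∂(G.map (Prod.map id Subtype.val : S × Ioi (0 : ℝ) → S × ℝ)) := by
  have ham := measurable_atomMass κ
  set Q : Measure (Ω × S) := P ⊗ₘ κ with hQdef
  set Z : Set (Ω × S) := {p | κ p.1 {p.2} = 0} with hZ
  have hZm : MeasurableSet Z := measurableSet_eq_fun ham measurable_const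
  have hQs : ∀ x : S, Q (Prod.snd ⁻¹' {x}) = 0 := by
    intro x
    rw [hQdef, Measure.compProd_apply (measurable_snd (measurableSet_singleton x))]
    rw [lintegral_congr_ae (g := fun _ ↦ 0)]
    · simp
    · filter_upwards [hatom x] with ω hω
      rw [← hω]
      rfl
  -- Off `Z`, the density `1 / κ(ω, {x})` turns `κ(ω, dx)` into the counting measure on the atoms.
  set D : Measure (Ω × S) := (Q.restrict Zᶜ).withDensity fun p ↦ (κ p.1 {p.2})⁻¹ with hD
  have hinv : Measurable fun p : Ω × S ↦ (κ p.1 {p.2})⁻¹ := ham.inv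
  set J : Ω × S → S × ℝ := fun p ↦ (p.2, (κ p.1 {p.2}).toReal) with hJ
  have hJm : Measurable J := measurable_snd.prodMk ham.ennreal_toReal
  set ι : S × Ioi (0 : ℝ) → S × ℝ := Prod.map id Subtype.val with hι
  have hιe : MeasurableEmbedding ι :=
    MeasurableEmbedding.id.prodMap (MeasurableEmbedding.subtype_coe measurableSet_Ioi)
  have hrange : ∀ᵐ p ∂D, J p ∈ range ι := by
    refine (withDensity_absolutelyContinuous _ _).ae_le ?_
    filter_upwards [ae_restrict_mem hZm.compl] with p hp
    exact ⟨(p.2, ⟨(κ p.1 {p.2}).toReal, ENNReal.toReal_pos hp (measure_ne_top _ _)⟩), rfl⟩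
  have hmap : ((D.map J).comap ι).map ι = D.map J := by
    rw [hιe.map_comap]
    refine Measure.restrict_eq_self_of_ae_mem ?_
    exact (ae_map_iff hJm.aemeasurable hιe.measurableSet_range).2 hrange
  have hDfin : IsFiniteMeasure D := by
    refine ⟨lt_of_le_of_lt (le_of_eq ?_) hlevy⟩
    rw [hD, withDensity_apply _ .univ, Measure.restrict_univ, ← lintegral_indicator hZm.compl,
      hQdef, Measure.lintegral_compProd (hinv.indicator hZm.compl)]
    refine lintegral_congr fun ω ↦ ?_
    rw [← lintegral_indicator]
    · rfl
    · exact hZm.compl.preimage measurable_prodMk_left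
  have hγfin : IsFiniteMeasure ((Q.restrict Z).map Prod.snd) := by
    refine ⟨lt_of_le_of_lt ?_ hQ⟩
    rw [Measure.map_apply measurable_snd .univ, preimage_univ, Measure.restrict_apply .univ,
      univ_inter]
    calc Q Z = ∫⁻ p in Z, clipRatio (κ p.1 {p.2}) ∂Q := by
          rw [setLIntegral_congr_fun (g := fun _ ↦ 1) hZm fun p hp ↦ by
            simp only [show κ p.1 {p.2} = 0 from hp, clipRatio_zero]]
          simp
      _ ≤ _ := setLIntegral_le_lintegral _ _
  have hDm : IsFiniteMeasure (D.map J) := inferInstance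
  refine ⟨(Q.restrict Z).map Prod.snd, (D.map J).comap ι, hγfin, fun x ↦ ?_, ?_, ?_, ?_⟩
  · rw [Measure.map_apply measurable_snd (measurableSet_singleton x)]
    exact nonpos_iff_eq_zero.1 ((Measure.restrict_apply_le _ _).trans (hQs x).le)
  · refine ⟨?_⟩
    rw [hιe.comap_apply]
    exact measure_lt_top _ _
  · intro B hB x
    rw [hιe.comap_apply]
    refine measure_mono_null (t := Prod.fst ⁻¹' {x}) ?_ ?_
    · rintro _ ⟨q, hq, rfl⟩
      exact hq.1
    · rw [Measure.map_apply hJm (measurable_fst (measurableSet_singleton x))]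
      exact withDensity_absolutelyContinuous _ _
        (nonpos_iff_eq_zero.1 ((Measure.restrict_apply_le _ _).trans (hQs x).le))
  · intro A hA θ
    have hUA : MeasurableSet ((univ : Set Ω) ×ˢ A) := MeasurableSet.univ.prod hA
    have hint : IntegrableOn (fun p : Ω × S ↦ charQuot θ (κ p.1 {p.2}).toReal) (univ ×ˢ A) Q := by
      refine (Integrable.mono' (integrable_charQuotBound hQ θ)
        ((continuous_charQuot θ).measurable.comp
          ham.ennreal_toReal).aestronglyMeasurable (ae_of_all _ fun p ↦ ?_)).integrableOn
      exact norm_charQuot_le_charQuotBound θ (measure_ne_top _ _) le_rfl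
    rw [hmap, ← integral_inter_add_sdiff hZm hint]
    congr 1
    · rw [setIntegral_congr_fun (g := fun _ ↦ Complex.I * θ) (hUA.inter hZm) fun p hp ↦ by
        simp only [show κ p.1 {p.2} = 0 from hp.2, ENNReal.toReal_zero, charQuot_zero],
        setIntegral_const, Complex.real_smul, mul_comm, measureReal_def, measureReal_def,
        Measure.map_apply measurable_snd hA, Measure.restrict_apply (measurable_snd hA),
        univ_prod]
    · have hmeasf : Measurable fun q : S × ℝ ↦ Complex.exp (Complex.I * θ * q.2) - 1 := by fun_prop
      rw [setIntegral_map (hA.prod .univ) hmeasf.aestronglyMeasurable hJm.aemeasurable, hD,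
        setIntegral_withDensity_eq_setIntegral_toReal_smul hinv ?_ _
          (hJm (hA.prod .univ)), Measure.restrict_restrict (hJm (hA.prod .univ))]
      · have hset : J ⁻¹' (A ×ˢ univ) ∩ Zᶜ = (univ ×ˢ A) \ Z := by
          ext p; simp [hJ]
        rw [hset]
        refine setIntegral_congr_fun (hUA.diff hZm) fun p hp ↦ ?_
        have h0 : (κ p.1 {p.2}).toReal ≠ 0 :=
          (ENNReal.toReal_pos hp.2 (measure_ne_top _ _)).ne'
        simp only [hJ]
        rw [← self_mul_charQuot, ENNReal.toReal_inv, Complex.real_smul, ← mul_assoc]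
        rw [← Complex.ofReal_mul, inv_mul_cancel₀ h0, Complex.ofReal_one, one_mul]
      · rw [Measure.restrict_restrict (hJm (hA.prod .univ))]
        filter_upwards [ae_restrict_mem ((hJm (hA.prod .univ)).inter hZm.compl)] with p hp
        exact ENNReal.inv_lt_top.2 (pos_iff_ne_zero.2 hp.2)

end Atomless

lemma IsCRM.iIndepFun_apply {S : Type*} [MetricSpace S] [MeasurableSpace S] {Ω : Type*}
    [MeasurableSpace Ω] {P : Measure Ω} {ξ : Ω → Measure S} (hξ : IsCRM P ξ) {ι : Type*}
    [Fintype ι] {B : ι → Set S} (hB : ∀ i, MeasurableSet (B i))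
    (hdisj : Pairwise fun i j ↦ Disjoint (B i) (B j)) :
    iIndepFun (fun i ω ↦ ξ ω (B i)) P := by
  let e := (Fintype.equivFin ι).symm
  have h := hξ.2 _ (fun i ↦ B (e i)) (fun i ↦ hB _)
    (fun i j hij ↦ hdisj (e.injective.ne hij))
  simpa using h.precomp e.symm.injective

/-- The Lévy–Khintchine formula for an atomless completely random measure that is almost surely
finite and has a finite Lévy measure. -/
theorem IsCRM.exists_charFun_eq {S : Type*} [MetricSpace S] [SecondCountableTopology S]
    [MeasurableSpace S] [BorelSpace S] {Ω : Type*} [MeasurableSpace Ω] {P : Measure Ω}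
    [IsProbabilityMeasure P] {α : Ω → Measure S} (hα : IsCRM P α) (hatom : IsAtomless P α)
    (hfin : ∀ᵐ ω ∂P, α ω univ < ∞) (hlevy : levyMeasure P α univ < ∞) :
    ∃ (γ : Measure S) (G : Measure (S × Ioi (0 : ℝ))),
      IsFiniteMeasure γ ∧ (∀ x : S, γ {x} = 0) ∧ IsFiniteMeasure G ∧
      (∀ B : Set (Ioi (0 : ℝ)), MeasurableSet B → ∀ x : S, G ({x} ×ˢ B) = 0) ∧
      ∀ A : Set S, MeasurableSet A → ∀ θ : ℝ,
        charFun (P.map fun ω ↦ (α ω A).toReal) θ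
          = Complex.exp (Complex.I * θ * (γ.real A : ℝ) + ∫ q in A ×ˢ (univ : Set ℝ),
            (Complex.exp (Complex.I * θ * q.2) - 1)
              ∂(G.map (Prod.map id Subtype.val : S × Ioi (0 : ℝ) → S × ℝ))) := by
  obtain ⟨κ, hκs, hκf, hκ⟩ := exists_sFiniteKernel hα.1.1
  have hae : ∀ᵐ ω ∂P, κ ω = α ω := hfin.mono hκ
  have hind : ∀ A, MeasurableSet A → ∀ n,
      iIndepFun (fun (w : Fin n → Bool) ω ↦ κ ω (cellTrace A n w)) P := by
    intro A hA n
    refine (hα.iIndepFun_apply (measurableSet_cellTrace hA n)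
      (pairwise_disjoint_cellTrace A n)).congr fun w ↦ ?_
    filter_upwards [hae] with ω hω
    rw [hω]
  have hatomκ : ∀ s : S, ∀ᵐ ω ∂P, κ ω {s} = 0 := by
    intro s
    filter_upwards [hae, hatom s] with ω h1 h2
    rw [h1, h2]
  have hQ := lintegral_clipRatio_atomMass_lt_top (hind univ .univ)
  have hlevyκ : ∫⁻ ω, ∫⁻ x in {x | κ ω {x} ≠ 0}, (κ ω {x})⁻¹ ∂(κ ω) ∂P < ∞ := by
    refine lt_of_le_of_lt (lintegral_mono_ae ?_) hlevy
    filter_upwards [hae] with ω hω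
    rw [← hω]
    exact lintegral_inv_atomMass_le (κ ω)
  obtain ⟨γ, G, h1, h2, h3, h4, h5⟩ := exists_measures_of_kernel hQ hatomκ hlevyκ
  refine ⟨γ, G, h1, h2, h3, h4, fun A hA θ ↦ ?_⟩
  have hαA : Measurable fun ω ↦ (α ω A).toReal :=
    ((Measure.measurable_coe hA).comp hα.1.1).ennreal_toReal
  rw [← h5 A hA, ← integral_exp_eq_exp_integral_charQuot hQ hatomκ hA (hind A hA),
    charFun_apply_real, integral_map hαA.aemeasurable (by fun_prop)]
  refine integral_congr_ae ?_
  filter_upwards [hae] with ω hω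
  rw [hω]
  congr 1
  ring

/-! ### The Lévy–Khintchine exponent of a characteristic pair -/

/-- The exponent `iθc + ∫ (e^{iθx} - 1) b(dx)` of a quasi-infinitely divisible law. -/
def qidExponent (c : ℝ) (b : SignedMeasure ℝ) (θ : ℝ) : ℂ :=
  Complex.I * θ * c + ∫ᵛ x, (Complex.exp (Complex.I * θ * x) - 1) ∂<•b

section Exponents

variable {S : Type*} [MeasurableSpace S]

/-- The exponent `iθγ(A) + ∫_A ∫ (e^{iθx} - 1) G(ds, dx)` of the value at `A` of an atomless
completely random measure. -/
def atomlessExponent (γ : Measure S) (G : Measure (S × Ioi (0 : ℝ))) (A : Set S) (θ : ℝ) : ℂ :=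
  Complex.I * θ * (γ.real A : ℝ) + ∫ q in A ×ˢ (univ : Set ℝ),
    (Complex.exp (Complex.I * θ * q.2) - 1)
      ∂(G.map (Prod.map id Subtype.val : S × Ioi (0 : ℝ) → S × ℝ))

lemma measurable_prodMap_id_subtypeVal :
    Measurable (Prod.map id Subtype.val : S × Ioi (0 : ℝ) → S × ℝ) :=
  measurable_id.prodMap measurable_subtype_coe

lemma slice_apply {F : SignedMeasure (S × ℝ)} {A : Set S} (hA : MeasurableSet A) {B : Set ℝ}
    (hB : MeasurableSet B) : slice F A B = F (A ×ˢ B) := by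
  rw [slice, VectorMeasure.map_apply _ measurable_snd hB,
    VectorMeasure.restrict_apply _ (hA.prod .univ) (measurable_snd hB)]
  congr 1
  ext p
  simp [and_comm]

lemma dirac_real_apply {s : S} {A : Set S} (hA : MeasurableSet A) :
    (Measure.dirac s).real A = A.indicator 1 s := by
  rw [measureReal_def, Measure.dirac_apply' _ hA]
  by_cases h : s ∈ A <;> simp [h]

/-- The exponent of a characteristic pair splits into that of its atomless part and those of the
fixed atoms in `A`. -/
lemma exponent_eq_of_decomposition {γ : Measure S} {G : Measure (S × Ioi (0 : ℝ))}
    [IsFiniteMeasure G] {n : ℕ} {s : Fin n → S} {c : Fin n → ℝ} {b : Fin n → SignedMeasure ℝ}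
    {ν₀ : SignedMeasure S} {F : SignedMeasure (S × ℝ)}
    (hν : ∀ A : Set S, MeasurableSet A →
      ν₀ A = γ.real A + ∑ j, (Measure.dirac (s j)).real A * c j)
    (hF : ∀ (A : Set S) (B : Set ℝ), MeasurableSet A → MeasurableSet B →
      F (A ×ˢ B) =
        (G.map (Prod.map id Subtype.val : S × Ioi (0 : ℝ) → S × ℝ)).real (A ×ˢ B)
          + ∑ j, (Measure.dirac (s j)).real A * b j B)
    {A : Set S} (hA : MeasurableSet A) (θ : ℝ) :
    Complex.I * θ * (ν₀ A : ℝ)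
        + ∫ᵛ x, (Complex.exp (Complex.I * θ * x) - 1) ∂<•(slice F A)
      = atomlessExponent γ G A θ
        + ∑ j, ((Measure.dirac (s j)).real A : ℝ) * qidExponent (c j) (b j) θ := by
  set G' := G.map (Prod.map id Subtype.val : S × Ioi (0 : ℝ) → S × ℝ) with hG'
  have hslice : slice F A = ((G'.restrict (A ×ˢ univ)).map Prod.snd).toSignedMeasure
      + ∑ j, (Measure.dirac (s j)).real A • b j := by
    ext B hB
    rw [slice_apply hA hB, hF A B hA hB, add_apply, Measure.toSignedMeasure_apply_measurable hB,
      map_measureReal_apply measurable_snd hB, measureReal_restrict_apply (measurable_snd hB)]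
    congr 1
    · congr 1
      ext p
      simp [and_comm]
    · simp
  rw [hslice, VectorMeasure.integral_add_vectorMeasure (integrable_exp_sub_one_vectorMeasure _ _)
    (integrable_exp_sub_one_vectorMeasure _ _), VectorMeasure.integral_toSignedMeasure,
    VectorMeasure.integral_finsetSum_vectorMeasure
      fun _ _ ↦ integrable_exp_sub_one_vectorMeasure _ _,
    integral_map measurable_snd.aemeasurable (by fun_prop), hν A hA]
  simp only [VectorMeasure.integral_smul_vectorMeasure, atomlessExponent, qidExponent, mul_add,
    Finset.sum_add_distrib, Complex.real_smul]
  push_cast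
  rw [mul_add, Finset.mul_sum]
  have : ∀ j, Complex.I * θ * (((Measure.dirac (s j)).real A : ℝ) * (c j : ℂ))
      = ((Measure.dirac (s j)).real A : ℝ) * (Complex.I * θ * c j) := fun j ↦ by ring
  simp only [this]
  ring

end Exponents

/-! ### Adding independent fixed atoms -/

section FixedAtoms

variable {S : Type*} [MeasurableSpace S] {Ω : Type*} [MeasurableSpace Ω] {P : Measure Ω}

lemma charFun_map_const_mul_one {X : Ω → ℝ} (hX : AEMeasurable X P) (θ : ℝ) :
    charFun (P.map fun ω ↦ θ * X ω) 1 = charFun (P.map X) θ := by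
  rw [charFun_map_mul_comp hX, mul_one]

variable [IsProbabilityMeasure P]

/-- The joint law of the values on disjoint sets after adding independent fixed atoms: each atom
contributes to at most one of the values. -/
lemma charFun_map_sum_add_atoms {α ξ : Ω → Measure S} {n : ℕ} {s : Fin n → S}
    {β : Fin n → Ω → ℝ≥0} (hα : Measurable α) (hfin : ∀ᵐ ω ∂P, α ω univ < ∞)
    (hβ : ∀ j, Measurable (β j)) (hβi : iIndepFun β P)
    (hαβ : IndepFun (fun ω j ↦ β j ω) α P)
    (hξ : ∀ᵐ ω ∂P, ξ ω = α ω + ∑ j, β j ω • Measure.dirac (s j))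
    {k : ℕ} {B : Fin k → Set S} (hB : ∀ i, MeasurableSet (B i))
    (hdisj : Pairwise fun i j ↦ Disjoint (B i) (B j)) (t : Fin k → ℝ) {E₀ : Fin k → ℂ}
    (hE₀ : charFun (P.map fun ω ↦ ∑ i, t i * (α ω (B i)).toReal) 1 = Complex.exp (∑ i, E₀ i))
    {E : Fin n → ℝ → ℂ}
    (hE : ∀ j θ, charFun (P.map fun ω ↦ (β j ω : ℝ)) θ = Complex.exp (E j θ)) :
    charFun (P.map fun ω ↦ ∑ i, t i * (ξ ω (B i)).toReal) 1 = Complex.exp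
      (∑ i, (E₀ i + ∑ j, ((Measure.dirac (s j)).real (B i) : ℝ) * E j (t i))) := by
  set d : Fin n → Fin k → ℝ := fun j i ↦ (Measure.dirac (s j)).real (B i) with hd
  set u : Fin n → ℝ := fun j ↦ ∑ i, t i * d j i with hu
  have hβ' : ∀ j, Measurable fun ω ↦ (β j ω : ℝ) := fun j ↦ (hβ j).coe_nnreal_real
  have hαB : ∀ i, Measurable fun ω ↦ (α ω (B i)).toReal := fun i ↦
    ((Measure.measurable_coe (hB i)).comp hα).ennreal_toReal
  have hdec : (fun ω ↦ ∑ i, t i * (ξ ω (B i)).toReal) =ᵐ[P]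
      fun ω ↦ ∑ i, t i * (α ω (B i)).toReal + ∑ j, u j * (β j ω : ℝ) := by
    filter_upwards [hξ, hfin] with ω hω hf
    have h1 : ∀ i, (ξ ω (B i)).toReal = (α ω (B i)).toReal + ∑ j, d j i * (β j ω : ℝ) := by
      intro i
      have hαtop : α ω (B i) ≠ ∞ := ((measure_mono (subset_univ _)).trans_lt hf).ne
      rw [hω, Measure.add_apply, Measure.finsetSum_apply, ENNReal.toReal_add hαtop,
        ENNReal.toReal_sum]
      · congr 1
        refine Finset.sum_congr rfl fun j _ ↦ ?_
        rw [Measure.smul_apply, ENNReal.smul_def, smul_eq_mul, ENNReal.toReal_mul,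
          ENNReal.coe_toReal, mul_comm]
        rfl
      · exact fun j _ ↦ measure_ne_top _ _
      · exact (ENNReal.sum_lt_top.2 fun j _ ↦ measure_lt_top _ _).ne
    simp only [h1, mul_add, Finset.sum_add_distrib, hu, Finset.mul_sum, Finset.sum_mul]
    congr 1
    rw [Finset.sum_comm]
    simp only [mul_assoc]
  have hindep : IndepFun (fun ω ↦ ∑ i, t i * (α ω (B i)).toReal)
      (fun ω ↦ ∑ j, u j * (β j ω : ℝ)) P := by
    have hf : Measurable fun μ : Measure S ↦ ∑ i, t i * (μ (B i)).toReal :=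
      Finset.measurable_sum _ fun i _ ↦
        ((Measure.measurable_coe (hB i)).ennreal_toReal).const_mul _
    have hg : Measurable fun v : Fin n → ℝ≥0 ↦ ∑ j, u j * (v j : ℝ) := by fun_prop
    exact hαβ.symm.comp hf hg
  have hprod : charFun (P.map fun ω ↦ ∑ j, u j * (β j ω : ℝ)) 1
      = ∏ j, charFun (P.map fun ω ↦ (β j ω : ℝ)) (u j) := by
    have hi : iIndepFun (fun j ω ↦ u j * (β j ω : ℝ)) P :=
      hβi.comp (fun j (x : ℝ≥0) ↦ u j * (x : ℝ)) fun j ↦ by fun_prop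
    rw [hi.charFun_map_fun_sum_eq_prod fun j ↦ ((hβ' j).const_mul _).aemeasurable,
      Finset.prod_apply]
    exact Finset.prod_congr rfl fun j _ ↦ charFun_map_const_mul_one (hβ' j).aemeasurable _
  have hatom : ∀ j, charFun (P.map fun ω ↦ (β j ω : ℝ)) (u j)
      = Complex.exp (∑ i, (d j i : ℂ) * E j (t i)) := by
    intro j
    have hprob : IsProbabilityMeasure (P.map fun ω ↦ (β j ω : ℝ)) :=
      Measure.isProbabilityMeasure_map (hβ' j).aemeasurable
    have hd' : ∀ i, d j i = (B i).indicator 1 (s j) := fun i ↦ dirac_real_apply (hB i)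
    by_cases h : ∃ i, s j ∈ B i
    · obtain ⟨i, hi⟩ := h
      have h1 : d j i = 1 := by rw [hd']; simp [hi]
      have h0 : ∀ i', i' ≠ i → d j i' = 0 := by
        intro i' hne
        rw [hd', indicator_of_notMem]
        exact fun h' ↦ Set.disjoint_left.1 (hdisj hne) h' hi
      have e1 : u j = t i := by
        rw [hu]
        simp only
        rw [Finset.sum_eq_single i (fun i' _ hne ↦ by rw [h0 i' hne, mul_zero]) (by simp), h1,
          mul_one]
      rw [e1, hE, Finset.sum_eq_single i (fun i' _ hne ↦ by simp [h0 i' hne]) (by simp), h1]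
      simp
    · push Not at h
      have h0 : ∀ i, d j i = 0 := fun i ↦ by rw [hd', indicator_of_notMem (h i)]
      have e1 : u j = 0 := by simp [hu, h0]
      rw [e1, charFun_zero]
      simp [h0]
  rw [Measure.map_congr hdec, hindep.charFun_map_fun_add_eq_mul
    (Finset.measurable_sum _ fun i _ ↦ (hαB i).const_mul _).aemeasurable
    (Finset.measurable_sum _ fun j _ ↦ (hβ' j).const_mul _).aemeasurable, Pi.mul_apply, hE₀, hprod]
  simp only [hatom]
  rw [← Complex.exp_sum, ← Complex.exp_add, Finset.sum_add_distrib]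
  congr 2
  rw [Finset.sum_comm]

end FixedAtoms

/-! ### From random measures to characteristic pairs -/

/-- The mean measures of the diffuse part and of the jumps of `α`, together with the triplets of the
fixed atoms, form a characteristic pair. -/
theorem InClassA.exists_isCharPair {S : Type*} [MetricSpace S] [SecondCountableTopology S]
    [MeasurableSpace S] [BorelSpace S] {Ω : Type*} [MeasurableSpace Ω] {P : Measure Ω}
    [IsProbabilityMeasure P] {ξ : Ω → Measure S} (h : InClassA P ξ) :
    ∃ (ν₀ : SignedMeasure S) (F : SignedMeasure (S × ℝ)),
      IsCharPair ν₀ F ∧ LevyKhintchine P ξ ν₀ F := by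
  obtain ⟨hξc, α, n, s, β, hα, hatom, hfin, hlevy, hs, hβ, htrip, hβi, hαβ, hξ⟩ := h
  obtain ⟨γ, G, hγ, hγd, hG, hGd, hchar⟩ := hα.exists_charFun_eq hatom hfin hlevy
  choose c b hcb using htrip
  have hβ' : ∀ j, Measurable fun ω ↦ (β j ω : ℝ) := fun j ↦ (hβ j).coe_nnreal_real
  have hE : ∀ j θ, charFun (P.map fun ω ↦ (β j ω : ℝ)) θ
      = Complex.exp (qidExponent (c j) (b j) θ) := by
    intro j θ
    rw [(hcb j).2, qidExponent]
    simp
  set G' := G.map (Prod.map id Subtype.val : S × Ioi (0 : ℝ) → S × ℝ) with hG'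
  set ν₀ : SignedMeasure S :=
    γ.toSignedMeasure + ∑ j, c j • (Measure.dirac (s j)).toSignedMeasure with hν₀
  set F : SignedMeasure (S × ℝ) :=
    G'.toSignedMeasure + ∑ j, (b j).map fun x ↦ (s j, x) with hF
  have hν : ∀ A : Set S, MeasurableSet A →
      ν₀ A = γ.real A + ∑ j, (Measure.dirac (s j)).real A * c j := by
    intro A hA
    simp [hν₀, Measure.toSignedMeasure_apply_measurable hA, mul_comm]
  have hFAB : ∀ (A : Set S) (B : Set ℝ), MeasurableSet A → MeasurableSet B →
      F (A ×ˢ B) = G'.real (A ×ˢ B) + ∑ j, (Measure.dirac (s j)).real A * b j B := by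
    intro A B hA hB
    rw [hF, add_apply, Measure.toSignedMeasure_apply_measurable (hA.prod hB)]
    congr 1
    simp only [sum_apply]
    refine Finset.sum_congr rfl fun j _ ↦ ?_
    rw [VectorMeasure.map_apply _ measurable_prodMk_left (hA.prod hB), dirac_real_apply hA]
    by_cases hj : s j ∈ A
    · simp [hj]
    · simp [hj]
  refine ⟨ν₀, F, ⟨γ, G, n, s, c, b, hγ, hγd, hG, hGd, hs, fun j ↦ ?_, hν, hFAB⟩, ?_⟩
  · refine exists_isExp_of_hasCharTriplet ?_ (hcb j)
    rw [Measure.map_apply (hβ' j) measurableSet_Iio]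
    convert measure_empty (μ := P)
    ext ω
    simp
  · intro A hA
    constructor
    · filter_upwards [hξ, hfin] with ω hω hf
      have hα : IsFiniteMeasure (α ω) := ⟨hf⟩
      rw [hω]
      exact measure_lt_top _ _
    · intro θ
      have hαm : Measurable fun ω ↦ (α ω A).toReal :=
        ((Measure.measurable_coe hA).comp hα.1.1).ennreal_toReal
      have hξm : AEMeasurable (fun ω ↦ (ξ ω A).toReal) P :=
        ((Measure.measurable_coe hA).comp hξc.1.1).ennreal_toReal.aemeasurable
      have h1 := charFun_map_sum_add_atoms hα.1.1 hfin hβ hβi hαβ hξ (k := 1) (B := fun _ ↦ A)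
        (fun _ ↦ hA) (fun i j hij ↦ (hij (Subsingleton.elim i j)).elim) (fun _ ↦ θ)
        (E₀ := fun _ ↦ atomlessExponent γ G A θ) ?_ hE
      · simp only [Finset.univ_unique, Finset.sum_singleton] at h1
        rw [charFun_map_const_mul_one hξm] at h1
        rw [h1, exponent_eq_of_decomposition hν hFAB hA]
      · simp only [Finset.univ_unique, Finset.sum_singleton]
        rw [charFun_map_const_mul_one hαm.aemeasurable, hchar A hA]
        rfl

/-! ### Poisson point processes of finite intensity -/

section Poisson

variable {E : Type*} [MeasurableSpace E]

lemma measurable_sigma_iff {E' : Type*} [MeasurableSpace E'] {f : (Σ m : ℕ, Fin m → E) → E'} :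
    Measurable f ↔ ∀ m, Measurable fun z : Fin m → E ↦ f ⟨m, z⟩ := by
  constructor
  · intro hf m
    refine hf.comp fun t ht ↦ ?_
    exact MeasurableSpace.measurableSet_iInf.1 ht m
  · intro hf t ht
    exact MeasurableSpace.measurableSet_iInf.2 fun m ↦ hf m ht

/-- The law of the enumerated points of a Poisson process of finite intensity `G`, on the space of
finite sequences: `e^{-G(E)} ∑ G^{⊗m} / m!`. -/
def poissonLaw (G : Measure E) : Measure (Σ m : ℕ, Fin m → E) :=
  ENNReal.ofReal (Real.exp (-G.real univ)) • Measure.sum fun m ↦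
    ((m.factorial : ℝ≥0∞))⁻¹ • (Measure.pi fun _ : Fin m ↦ G).map (Sigma.mk m)

variable (G : Measure E) [IsFiniteMeasure G]

lemma measurable_sigma_mk (m : ℕ) : Measurable (Sigma.mk (β := fun m : ℕ ↦ Fin m → E) m) :=
  measurable_sigma_iff.1 measurable_id m

lemma lintegral_pow_poissonLaw (r : ℝ≥0) :
    ∫⁻ ω, (r : ℝ≥0∞) ^ ω.1 ∂(poissonLaw G)
      = ENNReal.ofReal (Real.exp (-G.real univ)) * ENNReal.ofReal (Real.exp (r * G.real univ)) := by
  have hm : Measurable fun ω : Σ m : ℕ, Fin m → E ↦ (r : ℝ≥0∞) ^ ω.1 :=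
    measurable_sigma_iff.2 fun m ↦ (measurable_const : Measurable fun _ ↦ (r : ℝ≥0∞) ^ m)
  rw [poissonLaw, lintegral_smul_measure, lintegral_sum_measure, smul_eq_mul]
  congr 1
  rw [Real.exp_eq_exp_ℝ, NormedSpace.exp_eq_tsum_div,
    ENNReal.ofReal_tsum_of_nonneg (fun n ↦ by positivity) (Real.summable_pow_div_factorial _)]
  refine tsum_congr fun m ↦ ?_
  rw [lintegral_smul_measure, lintegral_map hm (measurable_sigma_mk m)]
  simp only [lintegral_const]
  rw [Measure.pi_univ, Finset.prod_const, Finset.card_univ, Fintype.card_fin, smul_eq_mul,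
    ENNReal.ofReal_div_of_pos (by positivity), ENNReal.ofReal_pow (by positivity),
    ENNReal.ofReal_mul (by positivity), ENNReal.ofReal_natCast, ENNReal.ofReal_coe_nnreal,
    ofReal_measureReal, ENNReal.div_eq_inv_mul, mul_pow]

instance isProbabilityMeasure_poissonLaw : IsProbabilityMeasure (poissonLaw G) := by
  have h := lintegral_pow_poissonLaw G 1
  rw [← ENNReal.ofReal_mul (Real.exp_pos _).le, ← Real.exp_add] at h
  exact ⟨by simpa using h⟩

/-- The number of points has finite mean. -/
lemma lintegral_card_poissonLaw_lt_top : ∫⁻ ω, (ω.1 : ℝ≥0∞) ∂(poissonLaw G) < ∞ := by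
  refine lt_of_le_of_lt (lintegral_mono fun ω ↦ ?_) (b := ∫⁻ ω, ((2 : ℝ≥0) : ℝ≥0∞) ^ ω.1
    ∂(poissonLaw G)) ?_
  · have : ω.1 ≤ 2 ^ ω.1 := Nat.lt_two_pow_self.le
    calc (ω.1 : ℝ≥0∞) ≤ ((2 ^ ω.1 : ℕ) : ℝ≥0∞) := by exact_mod_cast this
      _ = _ := by simp
  · rw [lintegral_pow_poissonLaw]
    finiteness

/-- Campbell's formula for the characteristic functional. -/
lemma integral_exp_sum_poissonLaw {g : E → ℝ} (hg : Measurable g) :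
    ∫ ω, Complex.exp (Complex.I * ((∑ k, g (ω.2 k) : ℝ) : ℂ)) ∂(poissonLaw G)
      = Complex.exp (∫ z, (Complex.exp (Complex.I * g z) - 1) ∂G) := by
  have hb : ∀ x : ℝ, ‖Complex.exp (Complex.I * x)‖ = 1 := fun x ↦ by
    rw [mul_comm, Complex.norm_exp_ofReal_mul_I]
  set f : (Σ m : ℕ, Fin m → E) → ℂ := fun ω ↦
    Complex.exp (Complex.I * ((∑ k, g (ω.2 k) : ℝ) : ℂ)) with hf
  have hfm : Measurable f := by
    refine measurable_sigma_iff.2 fun m ↦ ?_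
    have : Measurable fun z : Fin m → E ↦ ∑ k, g (z k) :=
      Finset.measurable_sum _ fun k _ ↦ hg.comp (measurable_pi_apply k)
    exact Complex.measurable_exp.comp ((Complex.measurable_ofReal.comp this).const_mul _)
  have hfi : Integrable f (poissonLaw G) :=
    Integrable.of_bound (C := 1) hfm.aestronglyMeasurable (ae_of_all _ fun ω ↦ (hb _).le)
  have hgi : Integrable (fun z ↦ Complex.exp (Complex.I * g z)) G :=
    Integrable.of_bound (C := 1) (Measurable.aestronglyMeasurable (by fun_prop))
      (ae_of_all _ fun ω ↦ (hb _).le)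
  set a : ℂ := ∫ z, Complex.exp (Complex.I * g z) ∂G with ha
  have hc0 : ENNReal.ofReal (Real.exp (-G.real univ)) ≠ 0 :=
    (ENNReal.ofReal_pos.2 (Real.exp_pos _)).ne'
  have hterm : ∀ m : ℕ, ∫ ω, f ω ∂(((m.factorial : ℝ≥0∞))⁻¹ •
      (Measure.pi fun _ : Fin m ↦ G).map (Sigma.mk m)) = a ^ m / (m.factorial : ℂ) := by
    intro m
    rw [integral_smul_measure, integral_map (measurable_sigma_mk m).aemeasurable
      hfm.aestronglyMeasurable]
    simp only [hf]
    have : ∀ z : Fin m → E, Complex.exp (Complex.I * ((∑ k, g (z k) : ℝ) : ℂ))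
        = ∏ k, Complex.exp (Complex.I * g (z k)) := by
      intro z
      rw [← Complex.exp_sum]
      push_cast
      rw [Finset.mul_sum]
    simp only [this]
    rw [integral_fintype_prod_eq_pow (fun z ↦ Complex.exp (Complex.I * g z)), Fintype.card_fin,
      ENNReal.toReal_inv, ENNReal.toReal_natCast, Complex.real_smul, div_eq_inv_mul]
    push_cast
    rfl
  rw [poissonLaw, integral_smul_measure]
  rw [poissonLaw, integrable_smul_measure hc0 ENNReal.ofReal_ne_top] at hfi
  rw [integral_sum_measure hfi, tsum_congr hterm, (NormedSpace.expSeries_div_hasSum_exp a).tsum_eq,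
    ← Complex.exp_eq_exp_ℂ, integral_sub hgi (integrable_const _), integral_const,
    ENNReal.toReal_ofReal (Real.exp_pos _).le, Complex.real_smul, Complex.ofReal_exp,
    ← Complex.exp_add]
  congr 1
  rw [Complex.real_smul]
  push_cast
  ring

lemma ae_poissonLaw_forall {A : Set E} (hA : MeasurableSet A) (h : G A = 0) :
    ∀ᵐ ω ∂(poissonLaw G), ∀ k, ω.2 k ∉ A := by
  have hm : MeasurableSet {ω : Σ m : ℕ, Fin m → E | ∀ k, ω.2 k ∉ A} := by
    refine MeasurableSpace.measurableSet_iInf.2 fun m ↦ ?_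
    have : MeasurableSet (⋂ k : Fin m, (fun z : Fin m → E ↦ z k) ⁻¹' Aᶜ) :=
      MeasurableSet.iInter fun k ↦ (measurable_pi_apply k) hA.compl
    have e : {z : Fin m → E | ∀ k : Fin m, z k ∉ A} = ⋂ k : Fin m, (fun z ↦ z k) ⁻¹' Aᶜ := by
      ext z
      simp
    rw [← e] at this
    exact this
  refine Measure.ae_smul_measure ((Measure.ae_sum_iff' hm).2 fun m ↦ ?_) _
  refine Measure.ae_smul_measure ?_ _
  rw [ae_map_iff (measurable_sigma_mk m).aemeasurable hm]
  exact ae_all_iff.2 fun k : Fin m ↦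
    (Measure.tendsto_eval_ae_ae (μ := fun _ : Fin m ↦ G)).eventually (compl_mem_ae_iff.2 h)

end Poisson

/-! ### Complete randomness from characteristic functions -/

lemma iIndepFun_of_charFun_sum {Ω : Type*} [MeasurableSpace Ω] {P : Measure Ω}
    [IsProbabilityMeasure P] {k : ℕ} {X : Fin k → Ω → ℝ} (hX : ∀ i, Measurable (X i))
    (h : ∀ t : Fin k → ℝ, charFun (P.map fun ω ↦ ∑ i, t i * X i ω) 1
      = ∏ i, charFun (P.map (X i)) (t i)) : iIndepFun X P := by
  rw [iIndepFun_iff_charFun_pi fun i ↦ (hX i).aemeasurable]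
  intro t
  rw [← h t.ofLp, charFun_apply, charFun_apply_real, integral_map (by fun_prop) (by fun_prop),
    integral_map (by fun_prop) (by fun_prop)]
  refine integral_congr_ae (ae_of_all _ fun ω ↦ ?_)
  simp [PiLp.inner_apply]

/-- A random measure is completely random if the joint characteristic functions of its values on
disjoint sets factorise. -/
lemma isCRM_of_charFun {S : Type*} [MetricSpace S] [MeasurableSpace S] {Ω : Type*}
    [MeasurableSpace Ω] {P : Measure Ω} [IsProbabilityMeasure P] {ξ : Ω → Measure S}
    (hξ : Measurable ξ) (hfin : ∀ ω, ξ ω univ < ∞) {E : Set S → ℝ → ℂ}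
    (h : ∀ (k : ℕ) (B : Fin k → Set S), (∀ i, MeasurableSet (B i)) →
      Pairwise (fun i j ↦ Disjoint (B i) (B j)) → ∀ t : Fin k → ℝ,
        charFun (P.map fun ω ↦ ∑ i, t i * (ξ ω (B i)).toReal) 1
          = Complex.exp (∑ i, E (B i) (t i))) : IsCRM P ξ := by
  refine ⟨⟨hξ, fun ω B _ _ ↦ (measure_mono (subset_univ B)).trans_lt (hfin ω)⟩, ?_⟩
  intro k B hB hdisj
  have hm : ∀ A, MeasurableSet A → Measurable fun ω ↦ (ξ ω A).toReal := fun A hA ↦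
    ((Measure.measurable_coe hA).comp hξ).ennreal_toReal
  have hone : ∀ A, MeasurableSet A → ∀ θ : ℝ,
      charFun (P.map fun ω ↦ (ξ ω A).toReal) θ = Complex.exp (E A θ) := by
    intro A hA θ
    have h1 := h 1 (fun _ ↦ A) (fun _ ↦ hA)
      (fun i j hij ↦ (hij (Subsingleton.elim i j)).elim) fun _ ↦ θ
    simp only [Finset.univ_unique, Finset.sum_singleton] at h1
    rwa [charFun_map_const_mul_one (hm A hA).aemeasurable] at h1
  have hreal : iIndepFun (fun i ω ↦ (ξ ω (B i)).toReal) P := by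
    refine iIndepFun_of_charFun_sum (fun i ↦ hm _ (hB i)) fun t ↦ ?_
    rw [h k B hB hdisj t, Complex.exp_sum]
    exact Finset.prod_congr rfl fun i _ ↦ (hone _ (hB i) _).symm
  have := hreal.comp (fun _ ↦ ENNReal.ofReal) fun _ ↦ ENNReal.measurable_ofReal
  convert this using 2 with i
  funext ω
  exact (ENNReal.ofReal_toReal ((measure_mono (subset_univ _)).trans_lt (hfin ω)).ne).symm

/-! ### Compound Poisson random measures -/

section CompoundPoisson

variable {S : Type*} [MeasurableSpace S]

/-- The random measure with deterministic part `γ` and with an atom of mass `x` at `s` for every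
point `(s, x)` of the configuration. -/
def compoundPoisson (γ : Measure S) (ω : Σ m : ℕ, Fin m → S × Ioi (0 : ℝ)) : Measure S :=
  γ + ∑ k, ENNReal.ofReal (ω.2 k).2 • Measure.dirac (ω.2 k).1

lemma compoundPoisson_apply (γ : Measure S) (ω : Σ m : ℕ, Fin m → S × Ioi (0 : ℝ)) (B : Set S) :
    compoundPoisson γ ω B
      = γ B + ∑ k, ENNReal.ofReal (ω.2 k).2 * Measure.dirac (ω.2 k).1 B := by
  simp [compoundPoisson, Measure.add_apply, Measure.finsetSum_apply]

lemma measurable_compoundPoisson (γ : Measure S) : Measurable (compoundPoisson γ) := by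
  refine Measure.measurable_of_measurable_coe _ fun B hB ↦ measurable_sigma_iff.2 fun m ↦ ?_
  simp only [compoundPoisson_apply]
  refine measurable_const.add (?_ : Measurable fun z : Fin m → S × Ioi (0 : ℝ) ↦
    ∑ k, ENNReal.ofReal (z k).2 * Measure.dirac (z k).1 B)
  refine Finset.measurable_sum _ fun k _ ↦ ?_
  have h1 : Measurable fun z : Fin m → S × Ioi (0 : ℝ) ↦ ENNReal.ofReal (z k).2 :=
    ENNReal.measurable_ofReal.comp
      (measurable_subtype_coe.comp (measurable_snd.comp (measurable_pi_apply k)))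
  have h2 : Measurable fun z : Fin m → S × Ioi (0 : ℝ) ↦ Measure.dirac (z k).1 B :=
    (Measure.measurable_coe hB).comp
      (Measure.measurable_dirac.comp (measurable_fst.comp (measurable_pi_apply k)))
  exact h1.mul h2

lemma ae_compoundPoisson_singleton [MeasurableSingletonClass S] {γ : Measure S}
    {G : Measure (S × Ioi (0 : ℝ))} [IsFiniteMeasure G] {x : S} (hγ : γ {x} = 0)
    (hG : G ({x} ×ˢ univ) = 0) : ∀ᵐ ω ∂(poissonLaw G), compoundPoisson γ ω {x} = 0 := by
  filter_upwards [ae_poissonLaw_forall G ((measurableSet_singleton x).prod .univ) hG] with ω hω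
  rw [compoundPoisson_apply, hγ, zero_add]
  refine Finset.sum_eq_zero fun k _ ↦ ?_
  have : (ω.2 k).1 ∉ ({x} : Set S) := fun h ↦ hω k ⟨h, mem_univ _⟩
  rw [Measure.dirac_apply' _ (measurableSet_singleton x), indicator_of_notMem this, mul_zero]

variable {γ : Measure S} [IsFiniteMeasure γ]

instance (ω : Σ m : ℕ, Fin m → S × Ioi (0 : ℝ)) : IsFiniteMeasure (compoundPoisson γ ω) := by
  refine ⟨?_⟩
  rw [compoundPoisson_apply]
  refine ENNReal.add_lt_top.2 ⟨measure_lt_top _ _, ENNReal.sum_lt_top.2 fun k _ ↦ ?_⟩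
  exact ENNReal.mul_lt_top ENNReal.ofReal_lt_top (measure_lt_top _ _)

lemma compoundPoisson_real_apply (ω : Σ m : ℕ, Fin m → S × Ioi (0 : ℝ)) {B : Set S}
    (hB : MeasurableSet B) :
    (compoundPoisson γ ω B).toReal
      = γ.real B + ∑ k, ((ω.2 k).2 : ℝ) * B.indicator 1 (ω.2 k).1 := by
  rw [compoundPoisson_apply, ENNReal.toReal_add (measure_ne_top _ _), ENNReal.toReal_sum]
  · congr 1
    refine Finset.sum_congr rfl fun k _ ↦ ?_
    rw [ENNReal.toReal_mul, ENNReal.toReal_ofReal (le_of_lt (ω.2 k).2.2), ← dirac_real_apply hB]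
    rfl
  · exact fun k _ ↦ ENNReal.mul_ne_top ENNReal.ofReal_ne_top (measure_ne_top _ _)
  · exact (ENNReal.sum_lt_top.2 fun k _ ↦
      ENNReal.mul_lt_top ENNReal.ofReal_lt_top (measure_lt_top _ _)).ne

/-- The joint characteristic functions of a compound Poisson random measure. -/
lemma charFun_sum_compoundPoisson (G : Measure (S × Ioi (0 : ℝ))) [IsFiniteMeasure G]
    {k : ℕ} {B : Fin k → Set S} (hB : ∀ i, MeasurableSet (B i))
    (hdisj : Pairwise fun i j ↦ Disjoint (B i) (B j)) (t : Fin k → ℝ) :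
    charFun ((poissonLaw G).map fun ω ↦ ∑ i, t i * (compoundPoisson γ ω (B i)).toReal) 1
      = Complex.exp (∑ i, atomlessExponent γ G (B i) (t i)) := by
  set g : S × Ioi (0 : ℝ) → ℝ := fun z ↦ ∑ i, t i * ((z.2 : ℝ) * (B i).indicator 1 z.1) with hg
  have hgm : Measurable g := by
    refine Finset.measurable_sum _ fun i _ ↦ Measurable.const_mul (Measurable.mul ?_ ?_) _
    · exact measurable_subtype_coe.comp measurable_snd
    · exact (measurable_one.indicator (hB i)).comp measurable_fst
  have hcm : Measurable fun ω ↦ ∑ i, t i * (compoundPoisson γ ω (B i)).toReal :=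
    Finset.measurable_sum _ fun i _ ↦ (((Measure.measurable_coe (hB i)).comp
      (measurable_compoundPoisson γ)).ennreal_toReal).const_mul _
  have hsum : ∀ ω, ∑ i, t i * (compoundPoisson γ ω (B i)).toReal
      = ∑ i, t i * γ.real (B i) + ∑ k, g (ω.2 k) := by
    intro ω
    simp only [compoundPoisson_real_apply ω (hB _), mul_add, Finset.sum_add_distrib, hg,
      Finset.mul_sum]
    congr 1
    exact Finset.sum_comm
  have hexp : ∀ z, Complex.exp (Complex.I * g z) - 1
      = ∑ i, ((B i) ×ˢ (univ : Set (Ioi (0 : ℝ)))).indicator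
          (fun z ↦ Complex.exp (Complex.I * t i * (z.2 : ℝ)) - 1) z := by
    intro z
    by_cases h : ∃ i, z.1 ∈ B i
    · obtain ⟨i, hi⟩ := h
      have h0 : ∀ i', i' ≠ i → z.1 ∉ B i' := fun i' hne h' ↦
        Set.disjoint_left.1 (hdisj hne) h' hi
      have e1 : g z = t i * (z.2 : ℝ) := by
        simp only [hg]
        rw [Finset.sum_eq_single i (fun i' _ hne ↦ by simp [h0 i' hne]) (by simp)]
        simp [hi]
      rw [e1, Finset.sum_eq_single i (fun i' _ hne ↦ by simp [h0 i' hne]) (by simp),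
        indicator_of_mem (by simpa using hi)]
      push_cast
      rw [mul_assoc]
    · push Not at h
      have e1 : g z = 0 := by simp [hg, h]
      rw [e1, Finset.sum_eq_zero fun i _ ↦ by simp [h i]]
      simp
  have hint : ∀ i, Integrable (((B i) ×ˢ (univ : Set (Ioi (0 : ℝ)))).indicator
      (fun z ↦ Complex.exp (Complex.I * t i * (z.2 : ℝ)) - 1)) G := by
    intro i
    refine Integrable.indicator ?_ ((hB i).prod .univ)
    have hm : Measurable fun z : S × Ioi (0 : ℝ) ↦ (z.2 : ℝ) :=
      measurable_subtype_coe.comp measurable_snd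
    refine Integrable.of_bound (C := 2) (Measurable.aestronglyMeasurable (by fun_prop))
      (ae_of_all _ fun z ↦ (norm_exp_I_mul_sub_one_le _ _).trans (min_le_left _ _))
  have hG : ∫ z, (Complex.exp (Complex.I * g z) - 1) ∂G
      = ∑ i, ∫ q in B i ×ˢ (univ : Set ℝ), (Complex.exp (Complex.I * t i * q.2) - 1)
          ∂(G.map (Prod.map id Subtype.val : S × Ioi (0 : ℝ) → S × ℝ)) := by
    simp only [hexp]
    rw [integral_finsetSum _ fun i _ ↦ hint i]
    refine Finset.sum_congr rfl fun i _ ↦ ?_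
    have hfm : Measurable fun q : S × ℝ ↦ Complex.exp (Complex.I * t i * q.2) - 1 := by fun_prop
    rw [integral_indicator ((hB i).prod .univ), setIntegral_map ((hB i).prod .univ)
      hfm.aestronglyMeasurable measurable_prodMap_id_subtypeVal.aemeasurable]
    congr 1
  rw [charFun_apply_real, integral_map hcm.aemeasurable (by fun_prop)]
  have hsplit : ∀ ω, Complex.exp (((1 : ℝ) : ℂ)
        * ((∑ i, t i * (compoundPoisson γ ω (B i)).toReal : ℝ) : ℂ) * Complex.I)
      = Complex.exp (∑ i, Complex.I * t i * (γ.real (B i) : ℝ))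
        * Complex.exp (Complex.I * ((∑ k, g (ω.2 k) : ℝ) : ℂ)) := by
    intro ω
    rw [hsum, ← Complex.exp_add]
    congr 1
    push_cast
    rw [one_mul, add_mul, Finset.sum_mul]
    congr 1
    · exact Finset.sum_congr rfl fun i _ ↦ by ring
    · ring
  simp only [hsplit]
  rw [integral_const_mul, integral_exp_sum_poissonLaw G hgm, hG, ← Complex.exp_add,
    ← Finset.sum_add_distrib]
  rfl

/-- A compound Poisson random measure with diffuse `γ` has at most as many atoms as the underlying
configuration has points. -/
lemma jumpMeasure_compoundPoisson_univ_le {S : Type*} [MetricSpace S] [MeasurableSpace S]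
    [MeasurableSingletonClass S] {γ : Measure S} (hγ : ∀ x, γ {x} = 0)
    (ω : Σ m : ℕ, Fin m → S × Ioi (0 : ℝ)) :
    jumpMeasure (compoundPoisson γ ω) univ ≤ ω.1 := by
  have hsub : {s | compoundPoisson γ ω {s} ≠ 0} ⊆ range fun k ↦ (ω.2 k).1 := by
    intro s hs
    by_contra hcon
    refine hs ?_
    rw [compoundPoisson_apply, hγ, zero_add]
    refine Finset.sum_eq_zero fun k _ ↦ ?_
    have : (ω.2 k).1 ∉ ({s} : Set S) := fun h ↦ hcon ⟨k, h⟩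
    rw [Measure.dirac_apply' _ (measurableSet_singleton s), indicator_of_notMem this, mul_zero]
  rw [jumpMeasure, Measure.sum_apply _ .univ]
  simp only [measure_univ]
  calc ∑' _ : {s // compoundPoisson γ ω {s} ≠ 0}, (1 : ℝ≥0∞)
      = ({s | compoundPoisson γ ω {s} ≠ 0}.encard : ℝ≥0∞) :=
        ENNReal.tsum_set_one {s | compoundPoisson γ ω {s} ≠ 0}
    _ ≤ ((ω.1 : ℕ∞) : ℝ≥0∞) := by
        refine ENat.toENNReal_le.2 ((encard_le_encard hsub).trans ?_)
        rw [← image_univ]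
        refine (encard_image_le _ _).trans ?_
        simp
    _ = ω.1 := by simp

end CompoundPoisson

/-! ### From characteristic pairs to random measures -/

/-- A characteristic pair is realised by a compound Poisson random measure and independent fixed
atoms with the laws of `exists_law_of_isExp`, on the product of their canonical spaces. -/
theorem IsCharPair.exists_inClassA {S : Type u} [MetricSpace S] [MeasurableSpace S]
    [BorelSpace S] {ν₀ : SignedMeasure S} {F : SignedMeasure (S × ℝ)} (h : IsCharPair ν₀ F) :
    ∃ (Ω : Type u) (_ : MeasurableSpace Ω) (P : Measure Ω) (ξ : Ω → Measure S),
      IsProbabilityMeasure P ∧ InClassA P ξ ∧ LevyKhintchine P ξ ν₀ F := by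
  obtain ⟨γ, G, n, s, c, b, hγ, hγd, hG, hGd, hs, hm, hν, hF⟩ := h
  choose m hmexp hmc using hm
  choose μ hμ htrip hμchar using fun j ↦ exists_law_of_isExp (hmexp j) (hmc j)
  let Ω₀ := Σ m : ℕ, Fin m → S × Ioi (0 : ℝ)
  let P : Measure (Ω₀ × (Fin n → ℝ≥0)) := (poissonLaw G).prod (Measure.pi μ)
  let α : Ω₀ × (Fin n → ℝ≥0) → Measure S := fun ω ↦ compoundPoisson γ ω.1
  let β : Fin n → Ω₀ × (Fin n → ℝ≥0) → ℝ≥0 := fun j ω ↦ ω.2 j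
  let ξ : Ω₀ × (Fin n → ℝ≥0) → Measure S := fun ω ↦ α ω + ∑ j, β j ω • Measure.dirac (s j)
  have hfst : P.map Prod.fst = poissonLaw G := by simp [P, Measure.map_fst_prod]
  have hsnd : P.map Prod.snd = Measure.pi μ := by simp [P, Measure.map_snd_prod]
  have hαm : Measurable α := (measurable_compoundPoisson γ).comp measurable_fst
  have hβm : ∀ j, Measurable (β j) := fun j ↦ (measurable_pi_apply j).comp measurable_snd
  have hαfin : ∀ ω, α ω univ < ∞ := fun ω ↦ measure_lt_top (compoundPoisson γ ω.1) _
  have hξfin : ∀ ω, ξ ω univ < ∞ := by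
    intro ω
    have : IsFiniteMeasure (α ω) := ⟨hαfin ω⟩
    exact measure_lt_top (α ω + ∑ j, β j ω • Measure.dirac (s j)) _
  have hξm : Measurable ξ := by
    refine Measure.measurable_of_measurable_coe _ fun B hB ↦ ?_
    simp only [ξ, Measure.add_apply, Measure.finsetSum_apply, Measure.smul_apply,
      ENNReal.smul_def, smul_eq_mul]
    exact ((Measure.measurable_coe hB).comp hαm).add
      (Finset.measurable_sum _ fun j _ ↦ (hβm j).coe_nnreal_ennreal.mul_const _)
  have hβmap : ∀ j, P.map (β j) = μ j := by
    intro j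
    rw [show β j = Function.eval j ∘ Prod.snd from rfl,
      ← Measure.map_map (measurable_pi_apply j) measurable_snd, hsnd]
    exact (measurePreserving_eval μ j).map_eq
  have hβlaw : ∀ j, P.map (fun ω ↦ (β j ω : ℝ)) = (μ j).map ((↑) : ℝ≥0 → ℝ) := by
    intro j
    rw [← hβmap j, Measure.map_map measurable_coe_nnreal_real (hβm j)]
    rfl
  have hE : ∀ j θ, charFun (P.map fun ω ↦ (β j ω : ℝ)) θ
      = Complex.exp (qidExponent (c j) (b j) θ) := by
    intro j θ
    rw [hβlaw, hμchar, qidExponent]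
  have hβi : iIndepFun β P := by
    rw [iIndepFun_iff_map_fun_eq_pi_map (fun j ↦ (hβm j).aemeasurable)]
    simp only [hβmap]
    exact hsnd
  have hαβ : IndepFun (fun ω j ↦ β j ω) α P :=
    ((indepFun_prod (μ := poissonLaw G) (ν := Measure.pi μ) (measurable_compoundPoisson γ)
      measurable_id).symm : IndepFun (fun ω : Ω₀ × (Fin n → ℝ≥0) ↦ id ω.2)
        (fun ω ↦ compoundPoisson γ ω.1) P)
  have hαchar : ∀ (k : ℕ) (B : Fin k → Set S), (∀ i, MeasurableSet (B i)) →
      Pairwise (fun i j ↦ Disjoint (B i) (B j)) → ∀ t : Fin k → ℝ,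
        charFun (P.map fun ω ↦ ∑ i, t i * (α ω (B i)).toReal) 1
          = Complex.exp (∑ i, atomlessExponent γ G (B i) (t i)) := by
    intro k B hB hdisj t
    rw [← charFun_sum_compoundPoisson G hB hdisj t, ← hfst, Measure.map_map ?_ measurable_fst]
    · rfl
    · exact Finset.measurable_sum _ fun i _ ↦ (((Measure.measurable_coe (hB i)).comp
        (measurable_compoundPoisson γ)).ennreal_toReal).const_mul _
  have hξchar : ∀ (k : ℕ) (B : Fin k → Set S), (∀ i, MeasurableSet (B i)) →
      Pairwise (fun i j ↦ Disjoint (B i) (B j)) → ∀ t : Fin k → ℝ,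
        charFun (P.map fun ω ↦ ∑ i, t i * (ξ ω (B i)).toReal) 1
          = Complex.exp (∑ i, (atomlessExponent γ G (B i) (t i)
            + ∑ j, ((Measure.dirac (s j)).real (B i) : ℝ) * qidExponent (c j) (b j) (t i))) :=
    fun k B hB hdisj t ↦ charFun_map_sum_add_atoms hαm (ae_of_all _ hαfin) hβm hβi hαβ
      (ae_of_all _ fun ω ↦ rfl) hB hdisj t (hαchar k B hB hdisj t) hE
  have hatom : IsAtomless P α := by
    intro x
    have h1 := ae_compoundPoisson_singleton (hγd x) (hGd univ .univ x)
    rw [← hfst] at h1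
    exact ae_of_ae_map measurable_fst.aemeasurable h1
  have hlevy : levyMeasure P α univ < ∞ := by
    refine lt_of_le_of_lt (lintegral_mono fun ω ↦
      jumpMeasure_compoundPoisson_univ_le hγd ω.1) ?_
    have h1 := lintegral_card_poissonLaw_lt_top G
    rw [← hfst, lintegral_map (measurable_sigma_iff.2 fun m ↦
      (measurable_const : Measurable fun _ ↦ (m : ℝ≥0∞))) measurable_fst] at h1
    exact h1
  refine ⟨Ω₀ × (Fin n → ℝ≥0), inferInstance, P, ξ, inferInstance,
    ⟨isCRM_of_charFun hξm hξfin
      (E := fun A θ ↦ atomlessExponent γ G A θ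
        + ∑ j, ((Measure.dirac (s j)).real A : ℝ) * qidExponent (c j) (b j) θ) hξchar,
      α, n, s, β, isCRM_of_charFun hαm hαfin hαchar, hatom, ae_of_all _ hαfin, hlevy, hs, hβm,
      fun j ↦ ⟨c j, _, by rw [hβlaw]; exact htrip j⟩, hβi, hαβ, ae_of_all _ fun ω ↦ rfl⟩, ?_⟩
  intro A hA
  refine ⟨ae_of_all _ fun ω ↦ (measure_mono (subset_univ _)).trans_lt (hξfin ω), fun θ ↦ ?_⟩
  have h1 := hξchar 1 (fun _ ↦ A) (fun _ ↦ hA)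
    (fun i j hij ↦ (hij (Subsingleton.elim i j)).elim) fun _ ↦ θ
  simp only [Finset.univ_unique, Finset.sum_singleton] at h1
  have hξA : Measurable fun ω ↦ (ξ ω A).toReal :=
    ((Measure.measurable_coe hA).comp hξm).ennreal_toReal
  rw [charFun_map_const_mul_one hξA.aemeasurable] at h1
  rw [exponent_eq_of_decomposition hν hF hA, ← h1]

/-! ### Uniqueness in law -/

section Uniqueness

variable {S : Type*} [MetricSpace S] [MeasurableSpace S] {Ω₁ Ω₂ : Type*} [MeasurableSpace Ω₁]
  [MeasurableSpace Ω₂] {P₁ : Measure Ω₁} {P₂ : Measure Ω₂} [IsProbabilityMeasure P₁]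
  [IsProbabilityMeasure P₂] {ξ₁ : Ω₁ → Measure S} {ξ₂ : Ω₂ → Measure S}

/-- The finite-dimensional laws of a completely random measure are determined by its
one-dimensional laws: the values on arbitrary sets are sums of the values on the atoms of the
finite algebra that they generate. -/
lemma IsCRM.map_apply_eq (h₁ : IsCRM P₁ ξ₁) (h₂ : IsCRM P₂ ξ₂)
    (h : ∀ A, MeasurableSet A → P₁.map (fun ω ↦ ξ₁ ω A) = P₂.map (fun ω ↦ ξ₂ ω A))
    {ι : Type*} [Fintype ι] {B : ι → Set S} (hB : ∀ i, MeasurableSet (B i)) :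
    P₁.map (fun ω i ↦ ξ₁ ω (B i)) = P₂.map (fun ω i ↦ ξ₂ ω (B i)) := by
  classical
  set D : (ι → Bool) → Set S := fun T ↦ {x | ∀ i, x ∈ B i ↔ T i = true} with hD
  have hDm : ∀ T, MeasurableSet (D T) := by
    intro T
    have : D T = ⋂ i, if T i = true then B i else (B i)ᶜ := by
      ext x
      simp only [hD, mem_ofPred_eq, mem_iInter]
      refine forall_congr' fun i ↦ ?_
      split_ifs with h <;> simp [h]
    rw [this]
    refine MeasurableSet.iInter fun i ↦ ?_
    split_ifs
    exacts [hB i, (hB i).compl]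
  have hDd : Pairwise fun T T' ↦ Disjoint (D T) (D T') := by
    intro T T' hne
    rw [Set.disjoint_left]
    intro x hx hx'
    refine hne (funext fun i ↦ ?_)
    have := (hx i).symm.trans (hx' i)
    rwa [Bool.eq_iff_iff]
  have hBD : ∀ (μ : Measure S) i, μ (B i) = ∑ T, if T i = true then μ (D T) else 0 := by
    intro μ i
    have h1 : B i = ⋃ T, B i ∩ D T := by
      rw [← inter_iUnion, eq_comm, inter_eq_left]
      intro x _
      exact mem_iUnion.2 ⟨fun i ↦ decide (x ∈ B i), fun i ↦ by simp⟩
    conv_lhs => rw [h1]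
    rw [measure_iUnion (fun T T' hne ↦ (hDd hne).mono inter_subset_right inter_subset_right)
      (fun T ↦ (hB i).inter (hDm T)), tsum_fintype]
    refine Finset.sum_congr rfl fun T _ ↦ ?_
    split_ifs with hT
    · congr 1
      exact inter_eq_right.2 fun x hx ↦ (hx i).2 hT
    · convert measure_empty (μ := μ)
      ext x
      simp only [mem_inter_iff, mem_empty_iff_false, iff_false, not_and]
      exact fun hx hx' ↦ hT ((hx' i).1 hx)
  set g : ((ι → Bool) → ℝ≥0∞) → ι → ℝ≥0∞ := fun v i ↦ ∑ T, if T i = true then v T else 0 with hg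
  have hgm : Measurable g := by
    refine measurable_pi_lambda _ fun i ↦ Finset.measurable_sum _ fun T _ ↦ ?_
    split_ifs
    exacts [measurable_pi_apply T, measurable_const]
  have hm₁ : ∀ T, Measurable fun ω ↦ ξ₁ ω (D T) := fun T ↦
    (Measure.measurable_coe (hDm T)).comp h₁.1.1
  have hm₂ : ∀ T, Measurable fun ω ↦ ξ₂ ω (D T) := fun T ↦
    (Measure.measurable_coe (hDm T)).comp h₂.1.1
  have e₁ : (fun ω i ↦ ξ₁ ω (B i)) = g ∘ fun ω T ↦ ξ₁ ω (D T) := by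
    funext ω i
    exact hBD _ i
  have e₂ : (fun ω i ↦ ξ₂ ω (B i)) = g ∘ fun ω T ↦ ξ₂ ω (D T) := by
    funext ω i
    exact hBD _ i
  rw [e₁, e₂, ← Measure.map_map hgm (measurable_pi_lambda _ hm₁),
    ← Measure.map_map hgm (measurable_pi_lambda _ hm₂),
    (iIndepFun_iff_map_fun_eq_pi_map fun T ↦ (hm₁ T).aemeasurable).1
      (h₁.iIndepFun_apply hDm hDd),
    (iIndepFun_iff_map_fun_eq_pi_map fun T ↦ (hm₂ T).aemeasurable).1
      (h₂.iIndepFun_apply hDm hDd)]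
  simp only [h _ (hDm _)]

/-- The law of a completely random measure is determined by its one-dimensional laws: the
preimages of rectangles under finitely many evaluations form a generating `π`-system. -/
theorem IsCRM.map_eq_of_map_apply_eq (h₁ : IsCRM P₁ ξ₁) (h₂ : IsCRM P₂ ξ₂)
    (h : ∀ A, MeasurableSet A → P₁.map (fun ω ↦ ξ₁ ω A) = P₂.map (fun ω ↦ ξ₂ ω A)) :
    P₁.map ξ₁ = P₂.map ξ₂ := by
  let m : {A : Set S // MeasurableSet A} → MeasurableSpace (Measure S) := fun A ↦
    (borel ℝ≥0∞).comap fun μ ↦ μ A.1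
  have hgen : (Measure.instMeasurableSpace : MeasurableSpace (Measure S))
      = MeasurableSpace.generateFrom
        (piiUnionInter (fun A ↦ {t | MeasurableSet[m A] t}) univ) := by
    refine Eq.trans ?_ (generateFrom_piiUnionInter_measurableSet m univ).symm
    simp only [mem_univ, iSup_pos, m]
    rw [iSup_subtype]
    rfl
  have := Measure.isProbabilityMeasure_map (μ := P₁) h₁.1.1.aemeasurable
  refine ext_of_generate_finite _ hgen
    (isPiSystem_piiUnionInter _ (fun A ↦ (m A).isPiSystem_measurableSet) _) ?_ ?_
  · rintro _ ⟨t, -, f, hf, rfl⟩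
    choose! C hC hfC using hf
    have hset : (⋂ A ∈ t, f A) = ⋂ A ∈ t, (fun μ : Measure S ↦ μ A.1) ⁻¹' C A :=
      iInter₂_congr fun A hA ↦ (hfC A hA).symm
    have hmeas : ∀ A ∈ t, MeasurableSet (C A) := fun A hA ↦
      (BorelSpace.measurable_eq (α := ℝ≥0∞)).symm ▸ hC A hA
    have hmS : MeasurableSet (⋂ A ∈ t, (fun μ : Measure S ↦ μ A.1) ⁻¹' C A) :=
      t.measurableSet_biInter fun A hA ↦ Measure.measurable_coe A.2 (hmeas A hA)
    have hpi : MeasurableSet {v : t → ℝ≥0∞ | ∀ A : t, v A ∈ C A} := by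
      have : {v : t → ℝ≥0∞ | ∀ A : t, v A ∈ C A} = ⋂ A : t, (fun v ↦ v A) ⁻¹' C A := by
        ext v
        simp
      rw [this]
      exact MeasurableSet.iInter fun A ↦ measurable_pi_apply A (hmeas A A.2)
    have hj := congrArg (fun ν : Measure (t → ℝ≥0∞) ↦ ν {v | ∀ A : t, v A ∈ C A})
      (IsCRM.map_apply_eq h₁ h₂ h (B := fun A : t ↦ A.1.1) fun A ↦ A.1.2)
    have m₁ : Measurable fun ω (A : t) ↦ ξ₁ ω A.1.1 := measurable_pi_lambda _ fun A ↦
      (Measure.measurable_coe A.1.2).comp h₁.1.1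
    have m₂ : Measurable fun ω (A : t) ↦ ξ₂ ω A.1.1 := measurable_pi_lambda _ fun A ↦
      (Measure.measurable_coe A.1.2).comp h₂.1.1
    beta_reduce at hj
    rw [Measure.map_apply m₁ hpi, Measure.map_apply m₂ hpi] at hj
    rw [hset, Measure.map_apply h₁.1.1 hmS, Measure.map_apply h₂.1.1 hmS]
    have e₁ : ξ₁ ⁻¹' (⋂ A ∈ t, (fun μ : Measure S ↦ μ A.1) ⁻¹' C A)
        = (fun ω (A : t) ↦ ξ₁ ω A.1.1) ⁻¹' {v | ∀ A : t, v A ∈ C A} := by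
      ext ω
      simp
    have e₂ : ξ₂ ⁻¹' (⋂ A ∈ t, (fun μ : Measure S ↦ μ A.1) ⁻¹' C A)
        = (fun ω (A : t) ↦ ξ₂ ω A.1.1) ⁻¹' {v | ∀ A : t, v A ∈ C A} := by
      ext ω
      simp
    rw [e₁, e₂, hj]
  · rw [Measure.map_apply h₁.1.1 .univ, Measure.map_apply h₂.1.1 .univ]
    simp

/-- The exponents determine the laws of the real numbers `ξ(A)`, and these determine the law of
`ξ`. -/
theorem LevyKhintchine.map_eq {ν₀ : SignedMeasure S} {F : SignedMeasure (S × ℝ)}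
    (h₁ : IsCRM P₁ ξ₁) (h₂ : IsCRM P₂ ξ₂) (hLK₁ : LevyKhintchine P₁ ξ₁ ν₀ F)
    (hLK₂ : LevyKhintchine P₂ ξ₂ ν₀ F) : P₁.map ξ₁ = P₂.map ξ₂ := by
  refine h₁.map_eq_of_map_apply_eq h₂ fun A hA ↦ ?_
  have hm₁ : Measurable fun ω ↦ (ξ₁ ω A).toReal :=
    ((Measure.measurable_coe hA).comp h₁.1.1).ennreal_toReal
  have hm₂ : Measurable fun ω ↦ (ξ₂ ω A).toReal :=
    ((Measure.measurable_coe hA).comp h₂.1.1).ennreal_toReal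
  have hreal : P₁.map (fun ω ↦ (ξ₁ ω A).toReal) = P₂.map (fun ω ↦ (ξ₂ ω A).toReal) := by
    have := Measure.isProbabilityMeasure_map (μ := P₁) hm₁.aemeasurable
    have := Measure.isProbabilityMeasure_map (μ := P₂) hm₂.aemeasurable
    refine Measure.ext_of_charFun ?_
    ext θ
    rw [(hLK₁ A hA).2, (hLK₂ A hA).2]
  have e₁ : (fun ω ↦ ξ₁ ω A) =ᵐ[P₁] ENNReal.ofReal ∘ fun ω ↦ (ξ₁ ω A).toReal := by
    filter_upwards [(hLK₁ A hA).1] with ω hω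
    exact (ENNReal.ofReal_toReal hω.ne).symm
  have e₂ : (fun ω ↦ ξ₂ ω A) =ᵐ[P₂] ENNReal.ofReal ∘ fun ω ↦ (ξ₂ ω A).toReal := by
    filter_upwards [(hLK₂ A hA).1] with ω hω
    exact (ENNReal.ofReal_toReal hω.ne).symm
  rw [Measure.map_congr e₁, Measure.map_congr e₂,
    ← Measure.map_map ENNReal.measurable_ofReal hm₁, hreal,
    Measure.map_map ENNReal.measurable_ofReal hm₂]

end Uniqueness

end QIDMeasure

end

theorem mainTheorem6 {S : Type u} [MetricSpace S] [CompleteSpace S] [SecondCountableTopology S]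
    [MeasurableSpace S] [BorelSpace S] :
    (∀ {Ω : Type v} [MeasurableSpace Ω] (P : MeasureTheory.Measure Ω)
        [MeasureTheory.IsProbabilityMeasure P] (ξ : Ω → MeasureTheory.Measure S),
        QIDMeasure.InClassA P ξ →
          ∃ (ν₀ : MeasureTheory.SignedMeasure S) (F : MeasureTheory.SignedMeasure (S × ℝ)),
            QIDMeasure.IsCharPair ν₀ F ∧ QIDMeasure.LevyKhintchine P ξ ν₀ F) ∧
    (∀ (ν₀ : MeasureTheory.SignedMeasure S) (F : MeasureTheory.SignedMeasure (S × ℝ)),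
        QIDMeasure.IsCharPair ν₀ F →
          (∃ (Ω : Type u) (_ : MeasurableSpace Ω) (P : MeasureTheory.Measure Ω)
              (ξ : Ω → MeasureTheory.Measure S),
              MeasureTheory.IsProbabilityMeasure P ∧
              QIDMeasure.InClassA P ξ ∧ QIDMeasure.LevyKhintchine P ξ ν₀ F) ∧
          (∀ {Ω₁ : Type v} {Ω₂ : Type w} [MeasurableSpace Ω₁] [MeasurableSpace Ω₂]
              (P₁ : MeasureTheory.Measure Ω₁) (P₂ : MeasureTheory.Measure Ω₂)
              [MeasureTheory.IsProbabilityMeasure P₁] [MeasureTheory.IsProbabilityMeasure P₂]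
              (ξ₁ : Ω₁ → MeasureTheory.Measure S) (ξ₂ : Ω₂ → MeasureTheory.Measure S),
              QIDMeasure.InClassA P₁ ξ₁ → QIDMeasure.LevyKhintchine P₁ ξ₁ ν₀ F →
              QIDMeasure.InClassA P₂ ξ₂ → QIDMeasure.LevyKhintchine P₂ ξ₂ ν₀ F →
                P₁.map ξ₁ = P₂.map ξ₂)) := by
  refine ⟨fun P _ ξ h ↦ h.exists_isCharPair, fun ν₀ F h ↦ ⟨h.exists_inClassA, ?_⟩⟩
  intro Ω₁ Ω₂ _ _ P₁ P₂ _ _ ξ₁ ξ₂ h₁ k₁ h₂ k₂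
  exact QIDMeasure.LevyKhintchine.map_eq h₁.1 h₂.1 k₁ k₂
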